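/- Let $d,L\ge 1$ be integers and let $\Lambda_L=(\mathbb Z/L\mathbb Z)^d$ be the periodic box of side length $L$; write $x\sim y$ if $x\neq y$ are nearest neighbours, i.e. $x-y=\pm e_i$ for some standard unit vector $e_i$. On the Hilbert space $\mathcal H=\bigotimes_{x\in\Lambda_L}\ell^2(\mathbb N)$, with bosonic annihilation and creation operators $a_x,a_x^\dagger$ and number operators $n_x=a_x^\dagger a_x$, consider the Bose–Hubbard Hamiltonian $$H=-J\sum_{x\sim y}a_x^\dagger a_y+\frac U2\sum_{x\in\Lambda_L}n_x(n_x-1)-\mu\sum_{x\in\Lambda_L}n_x$$ (the first sum runs over ordered pairs), taken on its maximal domain, with $J\in\mathbb R$, $U>0$ and $\mu>0$. Let $A\subset\Lambda_L$ be a slab of width $L_A\in\{1,\dots,L\}$ orthogonal to a coordinate direction, i.e. $A=\{x: x_j\in\{s,s+1,\dots,s+L_A-1\}\}$ for some $j$ and some $s\in\mathbb Z/L\mathbb Z$, and let $B=\Lambda_L\setminus A$. Then for every $\beta>0$ the operator $e^{-\beta H}$ is trace class, so that the Gibbs state $\rho=e^{-\beta H}/\operatorname{tr}e^{-\beta H}$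 is well defined. Moreover, with $\rho_A$, $\rho_B$ the reduced density matrices obtained from $\rho$ by the partial trace over the sites of $B$ and of $A$, respectively, and $S(\sigma)=-\operatorname{tr}(\sigma\ln\sigma)$, the entropies $S(\rho)$, $S(\rho_A)$, $S(\rho_B)$ are finite, and the mutual information $I(A:B)=S(\rho_A)+S(\rho_B)-S(\rho)$ satisfies $$I(A:B)\le c(J,U,\mu)\,\max\{1,\beta\}\,L^{d-1},$$ where, with $G=2d|J|+1+\mu$, $$c(J,U,\mu)=16|J|\left(\frac{16+4\cdot 6^{2(d-1)}(e-1)^{-2}}{2G}+\frac{U}{16\,G}+\frac{G}{U}+\frac12\right).$$ -/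

import Mathlib

noncomputable section

namespace BoseHubbard

open scoped ENNReal

/-! ### Operators on `ℓ²(κ)`: trace, entropy, thermal states -/

/-- The complex Hilbert space `ℓ²(κ)`. -/
abbrev L2 (κ : Type) : Type := lp (fun _ : κ => ℂ) 2

/-- Trace `∑ₖ ⟨δₖ, T δₖ⟩ ∈ [0, ∞]` of a positive bounded operator on `ℓ²(κ)`.
It is only applied to positive operators. -/
def posTrace {κ : Type} (T : L2 κ →L[ℂ] L2 κ) : ℝ≥0∞ :=
  open Classical in
  ∑' k : κ, ENNReal.ofReal (T (lp.single 2 k (1 : ℂ)) k).re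

/-- The operator `-T ln T` for a positive bounded operator `T` on a Hilbert space, by the continuous
functional calculus for `t ↦ -t ln t` (which is `0` at `t = 0`). -/
def opNegMulLog {E : Type} [NormedAddCommGroup E] [InnerProductSpace ℂ E] [CompleteSpace E]
    (T : E →L[ℂ] E) : E →L[ℂ] E :=
  cfc (p := IsSelfAdjoint) Real.negMulLog T

/-- The von Neumann entropy `S(ρ) = tr(-ρ ln ρ) ∈ [0, ∞]` of a density matrix `ρ`. -/
def entropy {κ : Type} (ρ : L2 κ →L[ℂ] L2 κ) : ℝ≥0∞ :=
  posTrace (opNegMulLog ρ)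

/-- `T = e^{-βH}` for an unbounded operator `H` with an orthonormal basis of eigenvectors in its
domain: `H bᵢ = εᵢ bᵢ` and `T bᵢ = e^{-βεᵢ} bᵢ`. -/
def IsHeatOperator {κ : Type} (H : L2 κ →ₗ.[ℂ] L2 κ) (β : ℝ) (T : L2 κ →L[ℂ] L2 κ) : Prop :=
  ∃ (ι : Type) (b : HilbertBasis ι ℂ (L2 κ)) (ε : ι → ℝ), ∀ i,
    (∃ h : b i ∈ H.domain, H ⟨b i, h⟩ = (ε i : ℂ) • b i) ∧
    T (b i) = (Real.exp (-β * ε i) : ℂ) • b i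

/-- `ρ = e^{-βH} / tr e^{-βH}`, where `tr e^{-βH} < ∞`. -/
def IsGibbsState {κ : Type} (H : L2 κ →ₗ.[ℂ] L2 κ) (β : ℝ) (ρ : L2 κ →L[ℂ] L2 κ) : Prop :=
  ∃ T : L2 κ →L[ℂ] L2 κ, IsHeatOperator H β T ∧ posTrace T ≠ ∞ ∧
    ρ = (((posTrace T).toReal⁻¹ : ℝ) : ℂ) • T

/-! ### Bosons on a set of sites -/

/-- Bosonic Hilbert space `⨂_{x ∈ S} ℓ²(ℕ)` of a finite set `S` of sites, in the occupation number
representation: the product basis vectors are labelled by the configurations `S → ℕ`. -/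
abbrev Fock (S : Type) : Type := L2 (S → ℕ)

section Reduced

variable {S : Type}

/-- The configuration on `S` equal to `k` on `X` and to `m` off `X`. -/
def glue (X : Set S) (m : {x // x ∉ X} → ℕ) (k : X → ℕ) : S → ℕ := fun x =>
  open Classical in
  if h : x ∈ X then k ⟨x, h⟩ else m ⟨x, h⟩

theorem glue_injective (X : Set S) (m : {x // x ∉ X} → ℕ) : Function.Injective (glue X m) := by
  intro k k' h
  funext x
  have := congrFun h x.1
  simpa [glue] using this

theorem sum_norm_rpow_comp_le {κ κ' : Type} (f : κ' → κ) (hf : Function.Injective f) (ψ : L2 κ)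
    (s : Finset κ') : ∑ k ∈ s, ‖ψ (f k)‖ ^ (2 : ℝ≥0∞).toReal ≤ ‖ψ‖ ^ (2 : ℝ≥0∞).toReal := by
  have := lp.sum_rpow_le_norm_rpow (p := 2) (by norm_num) ψ (s.map ⟨f, hf⟩)
  simpa using this

/-- The partial inner product with the product basis vector `δ_m` of the sites off `X`, i.e. the map
`1 ⊗ ⟨δ_m, ·⟩ : Fock S → Fock X`, `ψ ↦ (k ↦ ψ (k on X, m off X))`. -/
def slice (X : Set S) (m : {x // x ∉ X} → ℕ) : Fock S →L[ℂ] Fock X :=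
  LinearMap.mkContinuous
    { toFun := fun ψ => ⟨fun k => ψ (glue X m k),
        memℓp_gen' (sum_norm_rpow_comp_le _ (glue_injective X m) ψ)⟩
      map_add' := fun _ _ => rfl
      map_smul' := fun _ _ => rfl }
    1
    (fun ψ => by
      rw [one_mul]
      exact lp.norm_le_of_forall_sum_le (by norm_num) (norm_nonneg _)
        (sum_norm_rpow_comp_le _ (glue_injective X m) ψ))

/-- The reduced density matrix `ρ_X = ∑_m (1 ⊗ ⟨δ_m|) ρ (1 ⊗ |δ_m⟩)`: the partial trace of `ρ` over
the sites off `X`.  For a density matrix `ρ` the series converges absolutely in operator norm. -/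
def reduced (X : Set S) (ρ : Fock S →L[ℂ] Fock S) : Fock X →L[ℂ] Fock X :=
  ∑' m : {x // x ∉ X} → ℕ, slice X m ∘L ρ ∘L (slice X m).adjoint

/-- The mutual information `I(A:B) = S(ρ_A) + S(ρ_B) - S(ρ_{AB})`, where `B` is the complement of
`A`; meaningful when the three entropies are finite. -/
def mutualInformation (A : Set S) (ρ : Fock S →L[ℂ] Fock S) : ℝ :=
  (entropy (reduced A ρ)).toReal + (entropy (reduced Aᶜ ρ)).toReal - (entropy ρ).toReal

end Reduced

section Ladder

variable {S : Type} [DecidableEq S]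

/-- Annihilation operator on wave functions of the configuration, `a_x δ_n = √n_x δ_{n - e_x}`. -/
def annih (x : S) : Module.End ℂ ((S → ℕ) → ℂ) where
  toFun ψ := fun n => (Real.sqrt (n x + 1) : ℂ) * ψ (n + Pi.single x 1)
  map_add' ψ φ := by funext n; simp [mul_add]
  map_smul' c ψ := by funext n; simp [mul_left_comm]

/-- Creation operator on wave functions of the configuration, `a†_x δ_n = √(n_x + 1) δ_{n + e_x}`
(for `n x = 0` the truncated subtraction is harmless, the coefficient being zero). -/
def creat (x : S) : Module.End ℂ ((S → ℕ) → ℂ) where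
  toFun ψ := fun n => (Real.sqrt (n x) : ℂ) * ψ (n - Pi.single x 1)
  map_add' ψ φ := by funext n; simp [mul_add]
  map_smul' c ψ := by funext n; simp [mul_left_comm]

/-- Number operator `n_x = a†_x a_x`. -/
def num (x : S) : Module.End ℂ ((S → ℕ) → ℂ) := creat x * annih x

/-- The Bose-Hubbard expression on a finite graph,
`-J ∑_{x ∼ y} a†_x a_y + (U/2) ∑_x n_x (n_x - 1) - μ ∑_x n_x`;
the first sum is over ordered pairs of adjacent sites. -/
def hamiltonianExpr [Fintype S] (G : SimpleGraph S) (J U μ : ℝ) :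
    Module.End ℂ ((S → ℕ) → ℂ) :=
  open Classical in
  (-J : ℂ) • (∑ x, ∑ y, if G.Adj x y then creat x * annih y else 0)
    + (U / 2 : ℂ) • (∑ x, num x * (num x - 1))
    - (μ : ℂ) • ∑ x, num x

/-- The Bose-Hubbard Hamiltonian as an unbounded operator on the Hilbert space, on the largest
domain `{ψ ∈ Fock S | Hψ ∈ Fock S}`. -/
def hamiltonian [Fintype S] (G : SimpleGraph S) (J U μ : ℝ) : Fock S →ₗ.[ℂ] Fock S where
  domain :=
    { carrier := {ψ | Memℓp (hamiltonianExpr G J U μ (ψ : (S → ℕ) → ℂ)) 2}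
      add_mem' := fun {ψ φ} hψ hφ => by
        have := Memℓp.add hψ hφ
        simpa only [Set.mem_ofPred_eq, lp.coeFn_add, map_add] using this
      zero_mem' := by
        simpa only [Set.mem_ofPred_eq, lp.coeFn_zero, map_zero] using zero_memℓp
      smul_mem' := fun c ψ hψ => by
        have := Memℓp.const_smul hψ c
        simpa only [Set.mem_ofPred_eq, lp.coeFn_smul, map_smul] using this }
  toFun :=
    { toFun := fun ψ => ⟨hamiltonianExpr G J U μ (ψ.1 : (S → ℕ) → ℂ), ψ.2⟩
      map_add' := fun ψ φ => by
        apply Subtype.ext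
        exact map_add (hamiltonianExpr G J U μ) (ψ.1 : (S → ℕ) → ℂ) (φ.1 : (S → ℕ) → ℂ)
      map_smul' := fun c ψ => by
        apply Subtype.ext
        exact map_smul (hamiltonianExpr G J U μ) c (ψ.1 : (S → ℕ) → ℂ) }

end Ladder

/-! ### The periodic box -/

/-- The `d`-dimensional box of side length `L` with periodic boundary conditions. -/
abbrev Box (d L : ℕ) : Type := Fin d → ZMod L

/-- Nearest neighbours in the periodic box: distinct sites that differ by a unit vector. -/
def boxGraph (d L : ℕ) : SimpleGraph (Box d L) :=
  SimpleGraph.fromRel fun x y => ∃ i, y = x + Pi.single i 1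

/-- The slab of width `w` orthogonal to direction `j`, with first layer at `s`. -/
def slab {d L : ℕ} (j : Fin d) (s : ZMod L) (w : ℕ) : Set (Box d L) :=
  {x | (x j - s).val < w}

/-- The constant of the area law. -/
def areaConst (d : ℕ) (J U μ : ℝ) : ℝ :=
  16 * |J| *
    ((16 + 4 * 6 ^ (2 * (d - 1)) * ((Real.exp 1 - 1) ^ 2)⁻¹) / (2 * (2 * d * |J| + 1 + μ))
      + 1 / 16 * (U / (2 * d * |J| + 1 + μ))
      + (2 * d * |J| + 1 + μ) / U
      + 1 / 2)

end BoseHubbard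

end

/-! The bound is the Gibbs variational principle with the product of the marginals as trial state.
For the Gibbs state, S(ρ) = β tr(ρH) + ln Z. Klein's inequality (`tsum_negMulLog_le`), applied to
ρ_A ⊗ ρ_B against ρ, gives S(ρ_A) + S(ρ_B) ≤ β tr((ρ_A ⊗ ρ_B)H) + ln Z. Hence I(A:B) is at most β
times the difference of the two energies.

In that difference every on-site term, and every hopping term inside A or inside B, cancels, because
it sees only one marginal (`hasSum_marginal`). Hopping across the boundary vanishes in the product
state, since ρ_A commutes with the particle number of A. What is left is the boundary hopping in ρ
itself, and |⟨a†_x a_y⟩| ≤ (⟨n_x⟩ + ⟨n_y⟩)/2 by positivity of ρ (`summable_hop_and_norm_le`). By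
translation invariance all ⟨n_x⟩ equal one number n, and at most 4 L^(d-1) ordered pairs cross the
boundary, so I ≤ 4 |J| β n L^(d-1).

It remains to bound βn. The vacuum has energy zero, so Z ≥ 1 and β tr(ρH) ≤ S(ρ). Comparison with a
geometric product state gives S(ρ) ≤ ln 2 · (n + 1) per site, while the repulsion gives energy at
least (U/2)(n² - n) - (2d|J| + μ)n per site. Together they force βn ≤ 4 max(1, β)(G/U + 1/2)
(`density_ineq`, `mul_density_le`). This yields the constant 16|J|(G/U + 1/2); the other summands of
`areaConst` are nonnegative.

Unboundedness is handled through particle number conservation: H is block diagonal with finite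
blocks, so it has an eigenbasis of finitely supported vectors, and its eigenvalues outgrow every
multiple of the particle number. All weights thus decay exponentially in the particle number,
moments are summable, and changes of basis in traces are made one sector at a time. -/

noncomputable section

namespace BoseHubbard

open scoped ENNReal ComplexConjugate InnerProductSpace

/-! ### Matrix entries and eigenbases of operators on `ℓ²(κ)` -/

section Operators

variable {κ : Type}

open scoped Classical in
/-- The basis vector `δ_k` of `ℓ²(κ)`. -/
def ket (k : κ) : L2 κ := lp.single 2 k (1 : ℂ)

open scoped Classical in
theorem ket_apply (k l : κ) : ket k l = if l = k then 1 else 0 := by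
  simp only [ket, lp.coeFn_single, Pi.single_apply]

theorem inner_ket_left (k : κ) (ψ : L2 κ) : ⟪ket k, ψ⟫_ℂ = ψ k := by
  classical
  have := lp.inner_single_left (𝕜 := ℂ) (G := fun _ : κ => ℂ) k (1 : ℂ) ψ
  simp only [ket]
  convert! this using 1
  simp

theorem inner_ket_right (k : κ) (ψ : L2 κ) : ⟪ψ, ket k⟫_ℂ = conj (ψ k) := by
  rw [← inner_conj_symm, inner_ket_left]

/-- Evaluation at `k` as a continuous linear functional. -/
def evalL (k : κ) : L2 κ →L[ℂ] ℂ := innerSL ℂ (ket k)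

theorem evalL_apply (k : κ) (ψ : L2 κ) : evalL k ψ = ψ k := inner_ket_left k ψ

/-- The matrix entry `⟨δ_k, T δ_l⟩`. -/
def entry (T : L2 κ →L[ℂ] L2 κ) (k l : κ) : ℂ := T (ket l) k

theorem posTrace_eq_entry (T : L2 κ →L[ℂ] L2 κ) :
    posTrace T = ∑' k, ENNReal.ofReal (entry T k k).re := rfl

variable {ι : Type} (b : HilbertBasis ι ℂ (L2 κ))

theorem clm_ext_of_basis {E : Type*} [NormedAddCommGroup E] [NormedSpace ℂ E]
    {T T' : L2 κ →L[ℂ] E} (h : ∀ i, T (b i) = T' (b i)) : T = T' := by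
  refine ContinuousLinearMap.ext_on (s := Set.range b) ?_ ?_
  · rw [Submodule.dense_iff_topologicalClosure_eq_top]
    exact b.dense_span
  · rintro _ ⟨i, rfl⟩
    exact h i

theorem hasSum_expansion (ψ : L2 κ) : HasSum (fun i => ⟪b i, ψ⟫_ℂ • b i) ψ := by
  simpa only [b.repr_apply_apply] using b.hasSum_repr ψ

/-- Completeness relation: expand δ_l in the basis and evaluate at k. -/
theorem hasSum_conj_mul_apply (k l : κ) [Decidable (k = l)] :
    HasSum (fun i => b i k * conj (b i l)) (if k = l then 1 else 0) := by
  have h := (hasSum_expansion b (ket l)).mapL (evalL k)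
  simp only [map_smul, evalL_apply, inner_ket_right, ket_apply, smul_eq_mul] at h
  convert! h using 1
  · funext i
    rw [mul_comm]
  · congr

theorem hasSum_norm_sq_apply (k : κ) : HasSum (fun i => ‖b i k‖ ^ 2) 1 := by
  classical
  have h := hasSum_conj_mul_apply b k k
  simp only [Complex.mul_conj, Complex.normSq_eq_norm_sq, if_true] at h
  simpa [← Complex.ofReal_pow] using Complex.hasSum_re h

theorem hasSum_norm_sq (ψ : L2 κ) : HasSum (fun k => ‖ψ k‖ ^ 2) (‖ψ‖ ^ 2) := by
  have := lp.hasSum_norm (p := 2) (by norm_num) ψ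
  simpa using this

theorem hasSum_norm_sq_basis (i : ι) : HasSum (fun k => ‖b i k‖ ^ 2) 1 := by
  simpa [b.orthonormal.1 i] using hasSum_norm_sq (b i)

theorem hasSum_norm_sq_inner (ψ : L2 κ) : HasSum (fun i => ‖⟪b i, ψ⟫_ℂ‖ ^ 2) (‖ψ‖ ^ 2) := by
  have h := b.hasSum_inner_mul_inner ψ ψ
  have h2 : ∀ i, ⟪ψ, b i⟫_ℂ * ⟪b i, ψ⟫_ℂ = ((‖⟪b i, ψ⟫_ℂ‖ ^ 2 : ℝ) : ℂ) := by
    intro i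
    rw [← inner_conj_symm ψ (b i), mul_comm, Complex.mul_conj, Complex.normSq_eq_norm_sq]
  simp only [h2, inner_self_eq_norm_sq_to_K] at h
  convert! Complex.hasSum_re h using 1
  simp [← Complex.ofReal_pow]

theorem hasSum_entry {T : L2 κ →L[ℂ] L2 κ} {t : ι → ℂ} (hT : ∀ i, T (b i) = t i • b i) (k l : κ) :
    HasSum (fun i => t i * (b i k * conj (b i l))) (entry T k l) := by
  have h := (hasSum_expansion b (ket l)).mapL (evalL k ∘L T)
  simp only [map_smul, ContinuousLinearMap.comp_apply, hT, evalL_apply, inner_ket_right,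
    smul_eq_mul] at h
  convert! h using 1
  funext i
  ring

/-- Only the basis vectors occurring in ψ matter, and `T` multiplies each of them by `s`. This
compares two eigenbases without any multiplicity bookkeeping. -/
theorem apply_eq_of_inner_ne_zero {T : L2 κ →L[ℂ] L2 κ} {t : ι → ℂ}
    (hT : ∀ i, T (b i) = t i • b i) (ψ : L2 κ) (s : ℂ) (h : ∀ i, ⟪b i, ψ⟫_ℂ ≠ 0 → t i = s) :
    T ψ = s • ψ := by
  have h1 := (hasSum_expansion b ψ).mapL T
  have h2 := (hasSum_expansion b ψ).const_smul s
  refine h1.unique ?_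
  convert h2 using 1
  funext i
  rw [map_smul, hT]
  by_cases hi : ⟪b i, ψ⟫_ℂ = 0
  · simp [hi]
  · rw [h i hi, smul_comm]

/-- Tonelli on the nonnegative double family `t i * ‖b i k‖ ^ 2`: summing over `i` first gives the
diagonal entries, over `k` first the eigenvalues. -/
theorem posTrace_eq_tsum {T : L2 κ →L[ℂ] L2 κ} {t : ι → ℝ} (ht : ∀ i, 0 ≤ t i)
    (hT : ∀ i, T (b i) = (t i : ℂ) • b i) : posTrace T = ∑' i, ENNReal.ofReal (t i) := by
  have h1 : ∀ k, ENNReal.ofReal (entry T k k).re = ∑' i, ENNReal.ofReal (t i * ‖b i k‖ ^ 2) := by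
    intro k
    have h := Complex.hasSum_re (hasSum_entry b hT k k)
    have h' : (fun i => t i * ‖b i k‖ ^ 2) =
        fun i => ((t i : ℂ) * (b i k * conj (b i k))).re := by
      funext i
      rw [Complex.mul_conj, Complex.normSq_eq_norm_sq, ← Complex.ofReal_mul, Complex.ofReal_re]
    rw [← h'] at h
    rw [← h.tsum_eq, ENNReal.ofReal_tsum_of_nonneg (fun i => mul_nonneg (ht i) (sq_nonneg _))
      h.summable]
  rw [posTrace_eq_entry]
  simp only [h1]
  rw [ENNReal.tsum_comm]
  congr 1
  funext i
  have h := (hasSum_norm_sq_basis b i).mul_left (t i)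
  rw [← ENNReal.ofReal_tsum_of_nonneg (fun k => mul_nonneg (ht i) (sq_nonneg _)) h.summable,
    h.tsum_eq, mul_one]

theorem isSelfAdjoint_of_eigenbasis {T : L2 κ →L[ℂ] L2 κ} {t : ι → ℝ}
    (hT : ∀ i, T (b i) = (t i : ℂ) • b i) : IsSelfAdjoint T := by
  classical
  rw [ContinuousLinearMap.isSelfAdjoint_iff']
  refine clm_ext_of_basis b fun i => ?_
  refine b.repr.injective (lp.ext (funext fun j => ?_))
  rw [b.repr_apply_apply, b.repr_apply_apply, ContinuousLinearMap.adjoint_inner_right, hT, hT,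
    inner_smul_left, inner_smul_right, orthonormal_iff_ite.1 b.orthonormal j i]
  by_cases h : j = i
  · simp [h]
  · simp [h]

/-- The rank-one operators `c i |b i⟩⟨b i|` have norm `|c i|`, so their series converges in operator
norm. -/
theorem exists_diagonal {c : ι → ℝ} (hc : Summable c) :
    ∃ T : L2 κ →L[ℂ] L2 κ, ∀ i, T (b i) = (c i : ℂ) • b i := by
  classical
  let P : ι → L2 κ →L[ℂ] L2 κ := fun i => (c i : ℂ) • (innerSL ℂ (b i)).smulRight (b i)
  have hP : Summable P := by
    refine Summable.of_norm_bounded hc.norm fun i => ?_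
    rw [norm_smul, ContinuousLinearMap.norm_smulRight_apply, innerSL_apply_norm,
      b.orthonormal.1 i]
    simp
  refine ⟨∑' i, P i, fun i => ?_⟩
  have h := hP.hasSum.mapL (ContinuousLinearMap.apply ℂ (L2 κ) (b i))
  simp only [ContinuousLinearMap.apply_apply] at h
  refine h.unique ?_
  have h2 : ∀ j, j ≠ i → P j (b i) = 0 := by
    intro j hj
    change (c j : ℂ) • (⟪b j, b i⟫_ℂ • b j) = 0
    rw [orthonormal_iff_ite.1 b.orthonormal j i, if_neg hj, zero_smul, smul_zero]
  convert hasSum_single i h2 using 1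
  change _ = (c i : ℂ) • (⟪b i, b i⟫_ℂ • b i)
  rw [orthonormal_iff_ite.1 b.orthonormal i i, if_pos rfl, one_smul]

/-- The functional calculus acts on an eigenvector by the function of the eigenvalue. -/
theorem cfc_apply_eigenvector {E : Type} [NormedAddCommGroup E] [InnerProductSpace ℂ E]
    [CompleteSpace E] {T : E →L[ℂ] E} (hT : IsSelfAdjoint T) {v : E} (hv : v ≠ 0) {t : ℝ}
    (h : T v = (t : ℂ) • v) {f : ℝ → ℝ} (hf : Continuous f) :
    cfc (p := IsSelfAdjoint) f T v = (f t : ℂ) • v := by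
  -- `t - T` annihilates the nonzero vector `v`, so it is not invertible.
  have ht : t ∈ spectrum ℝ T := by
    intro hu
    obtain ⟨u, hu⟩ := hu
    have h0 : (u : E →L[ℂ] E) v = 0 := by
      rw [hu]
      simp [Algebra.algebraMap_eq_smul_one, h]
    have h1 : ((↑u⁻¹ : E →L[ℂ] E) * (u : E →L[ℂ] E)) v = 0 := by
      rw [mul_apply_eq_comp, h0, map_zero]
    rw [Units.inv_mul] at h1
    exact hv h1
  have key : ∀ g : C(spectrum ℝ T, ℝ), cfcHom hT g v = (g ⟨t, ht⟩ : ℂ) • v := by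
    intro g
    have hcomp : CompactSpace (spectrum ℝ T) :=
      isCompact_iff_compactSpace.1 (ContinuousFunctionalCalculus.isCompact_spectrum T)
    have hid : cfcHom hT (.restrict (spectrum ℝ T) <| .id ℝ) v = (t : ℂ) • v := by
      rw [cfcHom_id hT, h]
    -- Stone–Weierstrass: the claim holds for constants and the identity, and is stable under sums,
    -- products and uniform limits.
    induction g using ContinuousMap.induction_on_of_compact with
    | const r =>
      have : (ContinuousMap.const (spectrum ℝ T) r) = algebraMap ℝ _ r := rfl
      rw [this, AlgHomClass.commutes, Algebra.algebraMap_eq_smul_one]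
      simp
    | id => exact hid
    | star_id => simpa using hid
    | add f g hf hg => simp [hf, hg, add_smul]
    | mul f g hf hg =>
      rw [map_mul, mul_apply_eq_comp, hg, map_smul, hf, smul_smul]
      simp [mul_comm]
    | frequently f hf =>
      have hcl : IsClosed {g : C(spectrum ℝ T, ℝ) | cfcHom hT g v = (g ⟨t, ht⟩ : ℂ) • v} := by
        refine isClosed_eq ?_ ?_
        · exact (ContinuousLinearMap.apply ℂ E v).continuous.comp (cfcHom_continuous hT)
        · exact (Complex.continuous_ofReal.comp
            (continuous_eval_const _)).smul continuous_const
      exact hcl.mem_of_frequently_of_tendsto hf Filter.tendsto_id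
  rw [cfc_apply f T hT hf.continuousOn, key]
  rfl

theorem entropy_eq_tsum {T : L2 κ →L[ℂ] L2 κ} {p : ι → ℝ} (h0 : ∀ i, 0 ≤ p i)
    (h1 : ∀ i, p i ≤ 1) (hT : ∀ i, T (b i) = (p i : ℂ) • b i) :
    entropy T = ∑' i, ENNReal.ofReal (Real.negMulLog (p i)) := by
  refine posTrace_eq_tsum b (fun i => Real.negMulLog_nonneg (h0 i) (h1 i)) fun i => ?_
  exact cfc_apply_eigenvector (isSelfAdjoint_of_eigenbasis b hT) (b.orthonormal.ne_zero i) (hT i)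
    Real.continuous_negMulLog

/-- The inequality ln t ≤ t - 1 at t = r/p, multiplied by p. The linear terms are kept on opposite
sides so that both sides are nonnegative for p, r ≤ 1. -/
theorem negMulLog_add_le {p r : ℝ} (hp : 0 ≤ p) (hr : 0 < r) :
    Real.negMulLog p + p ≤ -Real.log r * p + r := by
  rcases hp.eq_or_lt with rfl | hp
  · simpa using hr.le
  · have h := Real.log_le_sub_one_of_pos (div_pos hr hp)
    rw [Real.log_div hr.ne' hp.ne'] at h
    have h2 : p * (r / p) = r := by field_simp
    rw [Real.negMulLog]
    nlinarith [mul_le_mul_of_nonneg_left h hp.le]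

/-- **Klein's inequality**: `S(σ) ≤ -tr σ ln ρ`, for `σ = ∑ p_a |b_a⟩⟨b_a|`, `ρ = ∑ r_i |c_i⟩⟨c_i|`. -/
theorem tsum_negMulLog_le {ι' : Type} (c : HilbertBasis ι' ℂ (L2 κ)) {p : ι → ℝ} {r : ι' → ℝ}
    (hp0 : ∀ a, 0 ≤ p a) (hp : HasSum p 1) (hr0 : ∀ i, 0 < r i) {s : ℝ} (hr : HasSum r s)
    (hs : s ≤ 1) :
    ∑' a, ENNReal.ofReal (Real.negMulLog (p a)) ≤
      ∑' i, ENNReal.ofReal (-Real.log (r i)) * ∑' a, ENNReal.ofReal (p a * ‖⟪b a, c i⟫_ℂ‖ ^ 2) := by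
  have hp1 : ∀ a, p a ≤ 1 := fun a => le_hasSum hp a fun _ _ => hp0 _
  have hr1 : ∀ i, r i ≤ 1 := fun i => (le_hasSum hr i fun _ _ => (hr0 _).le).trans hs
  have hrow : ∀ a, ∑' i, ENNReal.ofReal (‖⟪b a, c i⟫_ℂ‖ ^ 2) = 1 := by
    intro a
    have h := hasSum_norm_sq_inner c (b a)
    simp only [norm_inner_symm (c _) (b a), b.orthonormal.1 a, one_pow] at h
    rw [← ENNReal.ofReal_tsum_of_nonneg (fun _ => sq_nonneg _) h.summable, h.tsum_eq,
      ENNReal.ofReal_one]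
  have hcol : ∀ i, ∑' a, ENNReal.ofReal (‖⟪b a, c i⟫_ℂ‖ ^ 2) = 1 := by
    intro i
    have h := hasSum_norm_sq_inner b (c i)
    simp only [c.orthonormal.1 i, one_pow] at h
    rw [← ENNReal.ofReal_tsum_of_nonneg (fun _ => sq_nonneg _) h.summable, h.tsum_eq,
      ENNReal.ofReal_one]
  -- The scalar inequality weighted by the doubly stochastic |⟨b_a, c_i⟩|². No subtraction occurs,
  -- so everything can be summed in [0, ∞] in either order.
  have hterm : ∀ a i,
      ENNReal.ofReal (Real.negMulLog (p a)) * ENNReal.ofReal (‖⟪b a, c i⟫_ℂ‖ ^ 2)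
        + ENNReal.ofReal (p a) * ENNReal.ofReal (‖⟪b a, c i⟫_ℂ‖ ^ 2) ≤
      ENNReal.ofReal (-Real.log (r i)) * ENNReal.ofReal (p a * ‖⟪b a, c i⟫_ℂ‖ ^ 2)
        + ENNReal.ofReal (r i) * ENNReal.ofReal (‖⟪b a, c i⟫_ℂ‖ ^ 2) := by
    intro a i
    have hlog : 0 ≤ -Real.log (r i) := by
      have := Real.log_nonpos (hr0 i).le (hr1 i)
      linarith
    rw [ENNReal.ofReal_mul (hp0 a), ← mul_assoc, ← add_mul, ← add_mul, ← ENNReal.ofReal_mul hlog,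
      ← ENNReal.ofReal_add (Real.negMulLog_nonneg (hp0 a) (hp1 a)) (hp0 a),
      ← ENNReal.ofReal_add (mul_nonneg hlog (hp0 a)) (hr0 i).le]
    exact mul_le_mul_left (ENNReal.ofReal_le_ofReal (negMulLog_add_le (hp0 a) (hr0 i))) _
  have hsum := ENNReal.tsum_le_tsum fun a => ENNReal.tsum_le_tsum (hterm a)
  simp only [ENNReal.tsum_add, ENNReal.tsum_mul_left, hrow, mul_one] at hsum
  rw [← ENNReal.ofReal_tsum_of_nonneg hp0 hp.summable, hp.tsum_eq, ENNReal.ofReal_one,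
    ENNReal.tsum_comm, ENNReal.tsum_comm (f := fun a i => ENNReal.ofReal (r i) * _)] at hsum
  simp only [ENNReal.tsum_mul_left, hcol, mul_one] at hsum
  rw [← ENNReal.ofReal_tsum_of_nonneg (fun i => (hr0 i).le) hr.summable, hr.tsum_eq] at hsum
  have h1 : ENNReal.ofReal s ≤ 1 := by simpa using hs
  -- The added linear terms sum to 1 on the left and to `s ≤ 1` on the right, so they can be
  -- cancelled.
  exact (ENNReal.add_le_add_iff_right ENNReal.one_ne_top).1 (hsum.trans (by gcongr))

end Operators

/-! ### Spectral theorem for block-diagonal matrices with finite blocks -/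

section Graded

variable {κ γ : Type}

/-- The element of `ℓ²(κ)` with the given coefficients on a finite set. -/
def finVec (s : Finset κ) (u : s → ℂ) : L2 κ := ∑ k : s, u k • ket (k : κ)

theorem finVec_apply_mem {s : Finset κ} (u : s → ℂ) {l : κ} (h : l ∈ s) :
    finVec s u l = u ⟨l, h⟩ := by
  classical
  rw [finVec, lp.coeFn_sum, Finset.sum_apply, Finset.sum_eq_single ⟨l, h⟩]
  · simp [ket_apply]
  · intro k _ hk
    have : l ≠ k := fun e => hk (Subtype.ext e.symm)
    simp [ket_apply, this]
  · simp

theorem finVec_apply_notMem {s : Finset κ} (u : s → ℂ) {l : κ} (h : l ∉ s) :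
    finVec s u l = 0 := by
  classical
  rw [finVec, lp.coeFn_sum, Finset.sum_apply]
  refine Finset.sum_eq_zero fun k _ => ?_
  have : l ≠ k := fun e => h (e ▸ k.2)
  simp [ket_apply, this]

theorem inner_finVec (s : Finset κ) (u : s → ℂ) (ψ : L2 κ) :
    ⟪finVec s u, ψ⟫_ℂ = ∑ k : s, conj (u k) * ψ k := by
  simp [finVec, inner_ket_left, mul_comm]

theorem inner_eq_sum_of_support {s : Finset κ} {φ : L2 κ} (hφ : ∀ k ∉ s, φ k = 0) (ψ : L2 κ) :
    ⟪φ, ψ⟫_ℂ = ∑ k ∈ s, conj (φ k) * ψ k := by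
  rw [lp.inner_eq_tsum, tsum_eq_sum (s := s)]
  · simp [mul_comm]
  · intro k hk
    simp [hφ k hk]

theorem apply_eq_sum_of_support {s : Finset κ} {φ : L2 κ} (hφ : ∀ k ∉ s, φ k = 0)
    (T : L2 κ →L[ℂ] L2 κ) (k : κ) : T φ k = ∑ l ∈ s, entry T k l * φ l := by
  have h : φ = ∑ l ∈ s, φ l • ket l := by
    ext l
    classical
    rw [lp.coeFn_sum, Finset.sum_apply]
    by_cases hl : l ∈ s
    · simp [ket_apply, hl]
    · simp [ket_apply, hl, hφ l hl]
  conv_lhs => rw [h]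
  rw [map_sum, lp.coeFn_sum, Finset.sum_apply]
  simp [entry, mul_comm]

/-- Each finite block is a Hermitian matrix and has an orthonormal eigenbasis; their union is an
eigenbasis of the whole space. Eigenvectors of a block are labelled by the elements of that block,
so `κ` itself indexes the result. -/
theorem exists_graded_eigenbasis (deg : κ → γ) (blk : γ → Finset κ)
    (hblk : ∀ N k, k ∈ blk N ↔ deg k = N) (M : κ → κ → ℂ) (hM : ∀ k l, M l k = conj (M k l)) :
    ∃ (b : HilbertBasis κ ℂ (L2 κ)) (ε : κ → ℝ), (∀ i k, deg k ≠ deg i → b i k = 0) ∧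
      ∀ i k, deg k = deg i → ∑ l ∈ blk (deg i), M k l * b i l = ε i * b i k := by
  classical
  let A : ∀ N, Matrix (blk N) (blk N) ℂ := fun N => Matrix.of fun k l => M k l
  have hA : ∀ N, (A N).IsHermitian := fun N => by
    ext k l
    simp [A, Matrix.conjTranspose_apply, hM l k]
  let u : ∀ N, blk N → blk N → ℂ := fun N a k => (hA N).eigenvectorBasis a k
  let v : ∀ N, blk N → L2 κ := fun N a => finVec (blk N) (u N a)
  let e : ∀ i : κ, blk (deg i) := fun i => ⟨i, (hblk _ _).2 rfl⟩
  let w : κ → L2 κ := fun i => v (deg i) (e i)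
  have hw : ∀ i N (h : deg i = N), w i = v N ⟨i, (hblk _ _).2 h⟩ := by
    rintro i _ rfl
    rfl
  have hw0 : ∀ i k, deg k ≠ deg i → w i k = 0 := fun i k h =>
    finVec_apply_notMem _ (fun h' => h ((hblk _ _).1 h'))
  have hinner : ∀ N (a : blk N) (ψ : L2 κ),
      ⟪v N a, ψ⟫_ℂ = ⟪(hA N).eigenvectorBasis a, WithLp.toLp 2 fun k : blk N => ψ k⟫_ℂ := by
    intro N a ψ
    rw [inner_finVec, EuclideanSpace.inner_eq_star_dotProduct, dotProduct]
    refine Finset.sum_congr rfl fun k _ => ?_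
    rw [mul_comm]
    rfl
  have hself : ∀ N (a : blk N),
      (WithLp.toLp 2 fun k : blk N => v N a k) = (hA N).eigenvectorBasis a := by
    intro N a
    ext k
    exact finVec_apply_mem _ k.2
  have horth : Orthonormal ℂ w := by
    rw [orthonormal_iff_ite]
    intro i j
    by_cases h : deg j = deg i
    · rw [hw j _ h, hinner, hself, orthonormal_iff_ite.1 (hA _).eigenvectorBasis.orthonormal]
      simp [e, Subtype.ext_iff]
    · have hne : i ≠ j := fun h' => h (h' ▸ rfl)
      rw [if_neg hne, inner_finVec]
      refine Finset.sum_eq_zero fun k _ => ?_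
      rw [hw0 j k, mul_zero]
      rw [(hblk _ _).1 k.2]
      exact fun h' => h h'.symm
  -- A vector orthogonal to all eigenvectors restricts on each block to one orthogonal to a basis of
  -- that block, hence to zero.
  have hcomplete : (Submodule.span ℂ (Set.range w))ᗮ = ⊥ := by
    rw [Submodule.eq_bot_iff]
    intro ψ hψ
    ext k
    have h0 : ∀ a, ⟪(hA (deg k)).eigenvectorBasis a,
        WithLp.toLp 2 fun l : blk (deg k) => ψ l⟫_ℂ = 0 := by
      intro a
      have ha : deg a.1 = deg k := (hblk _ _).1 a.2
      rw [← hinner]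
      have := (Submodule.mem_orthogonal _ _).1 hψ (w a.1) (Submodule.subset_span ⟨a.1, rfl⟩)
      rwa [hw _ _ ha] at this
    have h1 : (WithLp.toLp 2 fun l : blk (deg k) => ψ l) = 0 := by
      apply (hA (deg k)).eigenvectorBasis.repr.injective
      ext a
      rw [OrthonormalBasis.repr_apply_apply, h0]
      simp
    have h2 := congrArg (fun f : EuclideanSpace ℂ (blk (deg k)) => f (e k)) h1
    simpa using h2
  refine ⟨HilbertBasis.mkOfOrthogonalEqBot horth hcomplete,
    fun i => (hA (deg i)).eigenvalues (e i), ?_, ?_⟩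
  · intro i k h
    rw [HilbertBasis.coe_mkOfOrthogonalEqBot]
    exact hw0 i k h
  · intro i k h
    rw [HilbertBasis.coe_mkOfOrthogonalEqBot]
    have h1 := congrFun ((hA (deg i)).mulVec_eigenvectorBasis (e i)) ⟨k, (hblk _ _).2 h⟩
    have h2 : w i k = (hA (deg i)).eigenvectorBasis (e i) ⟨k, (hblk _ _).2 h⟩ :=
      finVec_apply_mem _ _
    rw [h2, ← Finset.sum_coe_sort]
    simp only [Matrix.mulVec, dotProduct] at h1
    refine Eq.trans (Finset.sum_congr rfl fun l _ => ?_) (h1.trans ?_)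
    · have h3 : w i l = (hA (deg i)).eigenvectorBasis (e i) l := finVec_apply_mem _ l.2
      rw [h3]
      rfl
    · rw [Pi.smul_apply, Complex.real_smul]

end Graded

/-! ### Configurations -/

section Configurations

/-- Induction on the number of sites, splitting off one coordinate at a time. -/
theorem hasSum_prod_pi {f : ℕ → ℝ} (hf0 : ∀ n, 0 ≤ f n) {a : ℝ} (hf : HasSum f a)
    (S : Type) [Fintype S] :
    HasSum (fun k : S → ℕ => ∏ x, f (k x)) (a ^ Fintype.card S) := by
  refine Fintype.induction_empty_option
    (P := fun S _ => HasSum (fun k : S → ℕ => ∏ x, f (k x)) (a ^ Fintype.card S)) ?_ ?_ ?_ S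
  · intro α β _ e ih
    let _ : Fintype α := Fintype.ofEquiv β e.symm
    rw [← Fintype.card_congr e, ← (e.arrowCongr (Equiv.refl ℕ)).hasSum_iff]
    convert! ih using 1
    funext k
    simp only [Function.comp_apply]
    rw [← Equiv.prod_comp e]
    simp [Equiv.arrowCongr]
  · simp
  · intro α _ ih
    rw [Fintype.card_option, pow_succ',
      ← (Equiv.piOptionEquivProd (β := fun _ => ℕ)).symm.hasSum_iff]
    have hs : Summable fun p : ℕ × (α → ℕ) => f p.1 * ∏ x, f (p.2 x) :=
      hf.summable.mul_of_nonneg ih.summable hf0 fun k => Finset.prod_nonneg fun x _ => hf0 _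
    convert! hf.mul ih hs using 1
    funext p
    simp [Fintype.prod_option, Equiv.piOptionEquivProd]

variable {S : Type} [Fintype S]

/-- The total number of particles. -/
def deg (k : S → ℕ) : ℕ := ∑ x, k x

theorem le_deg (k : S → ℕ) (x : S) : k x ≤ deg k :=
  Finset.single_le_sum (f := k) (fun _ _ => Nat.zero_le _) (Finset.mem_univ x)

theorem summable_exp_neg_deg : Summable fun k : S → ℕ => Real.exp (-(deg k : ℝ)) := by
  have h : HasSum (fun n : ℕ => Real.exp (-1) ^ n) (1 - Real.exp (-1))⁻¹ :=
    hasSum_geometric_of_lt_one (Real.exp_pos _).le (by simp)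
  refine (hasSum_prod_pi (fun n => pow_nonneg (Real.exp_pos _).le n) h S).summable.congr fun k => ?_
  rw [Finset.prod_pow_eq_pow_sum, ← Real.exp_nat_mul]
  simp [deg]

/-- The product of the geometric distributions 2^(-(n+1)) at each site is a probability
distribution; it is the reference state of the entropy bound. -/
theorem hasSum_half_pow_deg :
    HasSum (fun k : S → ℕ => (1 / 2 : ℝ) ^ (deg k + Fintype.card S)) 1 := by
  have h : HasSum (fun n : ℕ => (1 / 2 : ℝ) ^ (n + 1)) 1 := by
    simpa [pow_succ, div_eq_mul_inv, mul_comm] using hasSum_geometric_two' (1 : ℝ)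
  convert! hasSum_prod_pi (fun n => by positivity) h S using 1
  · funext k
    rw [Finset.prod_pow_eq_pow_sum, Finset.sum_add_distrib]
    simp [deg]
  · simp

variable [DecidableEq S]

theorem deg_add_single (k : S → ℕ) (x : S) : deg (k + Pi.single x 1) = deg k + 1 := by
  simp [deg, Finset.sum_add_distrib]

/-- The finite set of configurations with `N` particles. -/
def sector (S : Type) [Fintype S] [DecidableEq S] (N : ℕ) : Finset (S → ℕ) :=
  Finset.piAntidiag Finset.univ N

theorem mem_sector (N : ℕ) (k : S → ℕ) : k ∈ sector S N ↔ deg k = N := by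
  simp [sector, deg]

end Configurations

/-! ### The Bose-Hubbard Hamiltonian in the occupation number basis -/

section Hamiltonian

/-- The matrix element of the hopping of a particle between `x` and `y`. -/
def hopCoef {S : Type} (x y : S) (k : S → ℕ) : ℝ := √(k x) * √(k y + 1)

theorem hopCoef_eq_zero {S : Type} {x y : S} {k : S → ℕ} (h : k x = 0) : hopCoef x y k = 0 := by
  simp [hopCoef, h]

variable {S : Type} [DecidableEq S]

/-- The configuration with one particle moved from `x` to `y`. -/
def hop (x y : S) (k : S → ℕ) : S → ℕ := k - Pi.single x 1 + Pi.single y 1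

theorem hop_add_single (x y : S) (n : S → ℕ) : hop x y (n + Pi.single x 1) = n + Pi.single y 1 := by
  simp [hop]

theorem hopCoef_add_single {x y : S} (hxy : x ≠ y) (n : S → ℕ) :
    hopCoef x y (n + Pi.single x 1) = √(n x + 1) * √(n y + 1) := by
  simp [hopCoef, hxy.symm]

theorem exists_eq_add_single {x : S} {k : S → ℕ} (h : k x ≠ 0) :
    ∃ n : S → ℕ, k = n + Pi.single x 1 := by
  refine ⟨k - Pi.single x 1, (tsub_add_cancel_of_le fun y => ?_).symm⟩
  by_cases hy : y = x
  · subst hy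
    simpa using Nat.one_le_iff_ne_zero.2 h
  · simp [hy]

/-- Configurations occupied at `x` are exactly the shifts `n + e_x`, each for one `n`. This
reindexes hopping sums so that truncated subtraction disappears. -/
theorem hasSum_add_single_iff {E : Type*} [AddCommGroup E] [TopologicalSpace E] {g : (S → ℕ) → E}
    {x : S} (hg : ∀ k, k x = 0 → g k = 0) {a : E} :
    HasSum (fun n : S → ℕ => g (n + Pi.single x 1)) a ↔ HasSum g a := by
  refine (add_left_injective (Pi.single x 1)).hasSum_iff (f := g) fun k hk => hg k ?_
  by_contra h0
  obtain ⟨n, rfl⟩ := exists_eq_add_single h0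
  exact hk ⟨n, rfl⟩

theorem creat_mul_annih_apply {x y : S} (hxy : x ≠ y) (ψ : (S → ℕ) → ℂ) (k : S → ℕ) :
    (creat x * annih y) ψ k = (hopCoef x y k : ℂ) * ψ (hop x y k) := by
  simp [creat, annih, hopCoef, hop, hxy.symm, mul_assoc]

theorem num_apply (x : S) (ψ : (S → ℕ) → ℂ) (k : S → ℕ) : num x ψ k = (k x : ℂ) * ψ k := by
  by_cases h : k x = 0
  · simp [num, creat, h]
  · obtain ⟨n, rfl⟩ := exists_eq_add_single h
    have : (√((n x : ℝ) + 1) : ℂ) * (√((n x : ℝ) + 1) : ℂ) = (n x : ℂ) + 1 := by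
      rw [← Complex.ofReal_mul, Real.mul_self_sqrt (by positivity)]
      simp
    simp [num, creat, annih, ← mul_assoc, this]

/-- Write `k = n + e_x` and `l = n + e_y`: the matrix element √(n_x + 1) √(n_y + 1) is symmetric in
`x` and `y`. -/
theorem hop_symm {x y : S} (hxy : x ≠ y) {k l : S → ℕ} (hk : k x ≠ 0) (h : hop x y k = l) :
    l y ≠ 0 ∧ hop y x l = k ∧ hopCoef y x l = hopCoef x y k := by
  obtain ⟨n, rfl⟩ := exists_eq_add_single hk
  rw [hop_add_single] at h
  subst h
  refine ⟨by simp, hop_add_single y x n, ?_⟩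
  rw [hopCoef_add_single hxy, hopCoef_add_single hxy.symm, mul_comm]

variable [Fintype S]

/-- The diagonal part `∑ₓ (U/2) nₓ(nₓ - 1) - μ nₓ` of the Hamiltonian. -/
def diagEnergy (U μ : ℝ) (k : S → ℕ) : ℝ := ∑ x, (U / 2 * (k x * (k x - 1)) - μ * k x)

open scoped Classical in
theorem hamiltonianExpr_apply (G : SimpleGraph S) (J U μ : ℝ) (ψ : (S → ℕ) → ℂ) (k : S → ℕ) :
    hamiltonianExpr G J U μ ψ k =
      -J * (∑ x, ∑ y, if G.Adj x y then (hopCoef x y k : ℂ) * ψ (hop x y k) else 0)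
        + diagEnergy U μ k * ψ k := by
  have h1 : ∀ x y, (if G.Adj x y then creat x * annih y else 0 :
      Module.End ℂ ((S → ℕ) → ℂ)) ψ k =
      if G.Adj x y then (hopCoef x y k : ℂ) * ψ (hop x y k) else 0 := by
    intro x y
    split_ifs with h
    · exact creat_mul_annih_apply h.ne ψ k
    · rfl
  have h2 : ∀ x, (num x * (num x - 1)) ψ k = (k x * (k x - 1) : ℂ) * ψ k := by
    intro x
    rw [Module.End.mul_apply, num_apply, LinearMap.sub_apply, Pi.sub_apply, num_apply,
      Module.End.one_apply]
    ring
  simp only [hamiltonianExpr, LinearMap.sub_apply, LinearMap.add_apply, LinearMap.smul_apply,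
    Pi.sub_apply, Pi.add_apply, Pi.smul_apply, smul_eq_mul, LinearMap.sum_apply, Finset.sum_apply,
    h1, h2, num_apply, diagEnergy]
  push_cast
  rw [Finset.sum_sub_distrib, ← Finset.mul_sum, ← Finset.mul_sum, ← Finset.sum_mul,
    ← Finset.sum_mul]
  ring

open scoped Classical in
/-- Matrix elements of the Hamiltonian. -/
def hMat (G : SimpleGraph S) (J U μ : ℝ) (k l : S → ℕ) : ℝ :=
  -J * (∑ x, ∑ y, if G.Adj x y then (if hop x y k = l then hopCoef x y k else 0) else 0)
    + if k = l then diagEnergy U μ k else 0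

/-- When `k x = 0` the truncated `hop x y k` can still equal `l`, but then the coefficient is zero;
otherwise `hop_symm` applies. -/
theorem hopTerm_symm {x y : S} (hxy : x ≠ y) (k l : S → ℕ) :
    (if hop x y k = l then hopCoef x y k else 0) =
      if hop y x l = k then hopCoef y x l else 0 := by
  by_cases h : k x ≠ 0 ∧ hop x y k = l
  · obtain ⟨-, h2, h3⟩ := hop_symm hxy h.1 h.2
    rw [if_pos h.2, if_pos h2, h3]
  · have h1 : (if hop x y k = l then hopCoef x y k else 0) = 0 := by
      split_ifs with h'
      · exact hopCoef_eq_zero (not_not.1 fun h'' => h ⟨h'', h'⟩)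
      · rfl
    rw [h1]
    split_ifs with h'
    · by_cases hl : l y = 0
      · rw [hopCoef_eq_zero hl]
      · obtain ⟨h2, h3, -⟩ := hop_symm hxy.symm hl h'
        exact absurd ⟨h2, h3⟩ h
    · rfl

theorem hMat_symm (G : SimpleGraph S) (J U μ : ℝ) (k l : S → ℕ) :
    hMat G J U μ k l = hMat G J U μ l k := by
  classical
  rw [hMat, hMat, Finset.sum_comm]
  congr 1
  · congr 1
    refine Finset.sum_congr rfl fun x _ => Finset.sum_congr rfl fun y _ => ?_
    by_cases h : G.Adj x y
    · rw [if_pos h, if_pos h.symm, hopTerm_symm h.symm.ne]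
    · rw [if_neg h, if_neg fun h' => h h'.symm]
  · by_cases h : k = l
    · simp [h]
    · simp [h, Ne.symm h]

theorem deg_hop (x y : S) {k : S → ℕ} (hk : k x ≠ 0) : deg (hop x y k) = deg k := by
  obtain ⟨n, rfl⟩ := exists_eq_add_single hk
  rw [hop_add_single, deg_add_single, deg_add_single]

/-- Hopping conserves the particle number, so a row of the matrix of H lives in one finite sector.
-/
theorem hamiltonianExpr_eq_sum (G : SimpleGraph S) (J U μ : ℝ) (ψ : (S → ℕ) → ℂ) (k : S → ℕ) :
    hamiltonianExpr G J U μ ψ k = ∑ l ∈ sector S (deg k), (hMat G J U μ k l : ℂ) * ψ l := by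
  classical
  have hk : k ∈ sector S (deg k) := (mem_sector _ _).2 rfl
  have h1 : ∀ x y, ∑ l ∈ sector S (deg k),
      ((if hop x y k = l then hopCoef x y k else 0 : ℝ) : ℂ) * ψ l =
        (hopCoef x y k : ℂ) * ψ (hop x y k) := by
    intro x y
    by_cases hx : k x = 0
    · simp [hopCoef_eq_zero hx]
    · rw [Finset.sum_eq_single (hop x y k)]
      · simp
      · intro l _ hl
        simp [hl.symm]
      · intro h
        exact absurd ((mem_sector _ _).2 (deg_hop x y hx)) h
  have h2 : ∀ l, (hMat G J U μ k l : ℂ) * ψ l =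
      -J * (∑ x, ∑ y, if G.Adj x y then
        ((if hop x y k = l then hopCoef x y k else 0 : ℝ) : ℂ) * ψ l else 0)
        + if k = l then diagEnergy U μ k * ψ l else 0 := by
    intro l
    rw [hMat]
    push_cast
    rw [add_mul, mul_assoc, Finset.sum_mul]
    simp only [Finset.sum_mul]
    congr 1
    · congr 1
      refine Finset.sum_congr rfl fun x _ => Finset.sum_congr rfl fun y _ => ?_
      split_ifs <;> simp
    · split_ifs <;> simp
  simp only [h2]
  rw [hamiltonianExpr_apply, Finset.sum_add_distrib, ← Finset.mul_sum, Finset.sum_ite_eq,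
    if_pos hk]
  congr 2
  rw [Finset.sum_comm (s := sector S (deg k))]
  refine Finset.sum_congr rfl fun x _ => ?_
  rw [Finset.sum_comm]
  refine Finset.sum_congr rfl fun y _ => ?_
  split_ifs
  · exact (h1 x y).symm
  · simp

end Hamiltonian

/-! ### Hopping terms and energy of a density matrix -/

section Energy

/-- AM–GM for √(sb) and √(ta). The pairing is crossed so that, for hopping, each occupation number
meets the weight of the configuration carrying it. -/
theorem sqrt_mul_le_of_sq_le {s t a b c : ℝ} (hs : 0 ≤ s) (ht : 0 ≤ t) (ha : 0 ≤ a) (hb : 0 ≤ b)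
    (h : c ^ 2 ≤ a * b) : √s * √t * c ≤ (s * b + t * a) / 2 := by
  have h1 : c ≤ √a * √b := by
    rw [← Real.sqrt_mul ha]
    exact Real.le_sqrt_of_sq_le h
  have h2 : √s * √t * c ≤ (√s * √b) * (√t * √a) := by
    calc √s * √t * c ≤ √s * √t * (√a * √b) := by gcongr
      _ = _ := by ring
  have h3 : (√s * √b) ^ 2 = s * b := by rw [mul_pow, Real.sq_sqrt hs, Real.sq_sqrt hb]
  have h4 : (√t * √a) ^ 2 = t * a := by rw [mul_pow, Real.sq_sqrt ht, Real.sq_sqrt ha]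
  nlinarith [sq_nonneg (√s * √b - √t * √a)]

variable {S : Type}

/-- The mean occupation number of the site `x`. -/
def mean (x : S) (p : (S → ℕ) → ℝ) : ℝ := ∑' k, (k x : ℝ) * p k

theorem Summable.mean_of_sq {x : S} {p : (S → ℕ) → ℝ} (hp : ∀ k, 0 ≤ p k)
    (h : Summable fun k => (k x : ℝ) ^ 2 * p k) : Summable fun k => (k x : ℝ) * p k := by
  refine Summable.of_nonneg_of_le (fun k => mul_nonneg (Nat.cast_nonneg _) (hp k)) (fun k => ?_) h
  refine mul_le_mul_of_nonneg_right ?_ (hp k)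
  exact_mod_cast Nat.le_self_pow two_ne_zero (k x)

/-- The variance is nonnegative. -/
theorem sq_mean_le {x : S} {p : (S → ℕ) → ℝ} (hp : ∀ k, 0 ≤ p k) (h1 : HasSum p 1)
    (h : Summable fun k => (k x : ℝ) ^ 2 * p k) : mean x p ^ 2 ≤ ∑' k, (k x : ℝ) ^ 2 * p k := by
  have hm := (Summable.mean_of_sq hp h).hasSum
  have hs := (h.hasSum.sub (hm.mul_left (2 * mean x p))).add (h1.mul_left (mean x p ^ 2))
  have h0 := hs.nonneg fun k => by
    have := mul_nonneg (sq_nonneg ((k x : ℝ) - mean x p)) (hp k)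
    nlinarith
  have hm' : ∑' k : S → ℕ, (k x : ℝ) * p k = mean x p := rfl
  rw [hm'] at h0
  nlinarith

theorem hasSum_diagEnergy [Fintype S] (U μ : ℝ) {p : (S → ℕ) → ℝ} (hp : ∀ k, 0 ≤ p k)
    (h2 : ∀ x, Summable fun k : S → ℕ => (k x : ℝ) ^ 2 * p k) :
    HasSum (fun k : S → ℕ => diagEnergy U μ k * p k)
      (∑ x, (U / 2 * ((∑' k : S → ℕ, (k x : ℝ) ^ 2 * p k) - mean x p) - μ * mean x p)) := by
  have h : ∀ x, HasSum (fun k : S → ℕ =>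
        U / 2 * ((k x : ℝ) ^ 2 * p k - k x * p k) - μ * (k x * p k))
      (U / 2 * ((∑' k : S → ℕ, (k x : ℝ) ^ 2 * p k) - mean x p) - μ * mean x p) := fun x =>
    (((h2 x).hasSum.sub (Summable.mean_of_sq hp (h2 x)).hasSum).mul_left _).sub
      ((Summable.mean_of_sq hp (h2 x)).hasSum.mul_left _)
  convert! hasSum_sum (s := Finset.univ) fun x _ => h x using 1
  funext k
  rw [diagEnergy, Finset.sum_mul]
  refine Finset.sum_congr rfl fun x _ => ?_
  ring

open scoped Classical in
-- By symmetry of adjacency the two halves of the sum agree, and each counts `m x` once per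
-- neighbour.
theorem sum_adj_mean_le [Fintype S] (G : SimpleGraph S) {Δ : ℝ}
    (hΔ : ∀ x, (∑ y, if G.Adj x y then (1 : ℝ) else 0) ≤ Δ) {m : S → ℝ} (hm : ∀ x, 0 ≤ m x) :
    (∑ x, ∑ y, if G.Adj x y then (m x + m y) / 2 else 0) ≤ Δ * ∑ x, m x := by
  have h1 : (∑ x, ∑ y, if G.Adj x y then m x else 0) ≤ Δ * ∑ x, m x := by
    rw [Finset.mul_sum]
    refine Finset.sum_le_sum fun x _ => ?_
    have := mul_le_mul_of_nonneg_right (hΔ x) (hm x)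
    rw [Finset.sum_mul] at this
    simpa only [ite_mul, one_mul, zero_mul] using this
  have h2 : (∑ x, ∑ y, if G.Adj x y then m y else 0) = ∑ x, ∑ y, if G.Adj x y then m x else 0 := by
    rw [Finset.sum_comm]
    simp only [G.adj_comm]
  have h3 : (∑ x, ∑ y, if G.Adj x y then (m x + m y) / 2 else 0) =
      ((∑ x, ∑ y, if G.Adj x y then m x else 0) + ∑ x, ∑ y, if G.Adj x y then m y else 0) / 2 := by
    rw [← Finset.sum_add_distrib, Finset.sum_div]
    refine Finset.sum_congr rfl fun x _ => ?_
    rw [← Finset.sum_add_distrib, Finset.sum_div]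
    refine Finset.sum_congr rfl fun y _ => ?_
    split_ifs <;> simp
  rw [h3, h2]
  linarith

variable [DecidableEq S]

/-- The expectation `tr(f a†ₓ a_y)` of the hopping term. -/
def hopExp (x y : S) (f : (S → ℕ) → (S → ℕ) → ℂ) : ℂ :=
  ∑' k, (hopCoef x y k : ℂ) * f (hop x y k) k

/-- With `k = n + e_x`, the term is √(n_x + 1) √(n_y + 1) f(n + e_y, n + e_x). Positivity of `f` and
AM–GM bound it by half of the `x`-occupation at `n + e_x` plus the `y`-occupation at `n + e_y`, and
these sum to the two means. -/
theorem summable_hop_and_norm_le {x y : S} (hxy : x ≠ y) {f : (S → ℕ) → (S → ℕ) → ℂ}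
    {p : (S → ℕ) → ℝ} (hp : ∀ k, 0 ≤ p k) (hf : ∀ k l, ‖f k l‖ ^ 2 ≤ p k * p l)
    (hx : Summable fun k => (k x : ℝ) * p k) (hy : Summable fun k => (k y : ℝ) * p k) :
    (Summable fun k => (hopCoef x y k : ℂ) * f (hop x y k) k) ∧
      ‖hopExp x y f‖ ≤ (mean x p + mean y p) / 2 := by
  have hzero : ∀ z : S, ∀ k : S → ℕ, k z = 0 → (k z : ℝ) * p k = 0 := fun z k h => by simp [h]
  have hx' := (hasSum_add_single_iff (hzero x)).2 hx.hasSum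
  have hy' := (hasSum_add_single_iff (hzero y)).2 hy.hasSum
  have hsum := (hx'.add hy').div_const 2
  have hbound : ∀ n : S → ℕ,
      ‖(hopCoef x y (n + Pi.single x 1) : ℂ) *
        f (hop x y (n + Pi.single x 1)) (n + Pi.single x 1)‖ ≤
      (((n + Pi.single x 1 : S → ℕ) x : ℝ) * p (n + Pi.single x 1) +
        ((n + Pi.single y 1 : S → ℕ) y : ℝ) * p (n + Pi.single y 1)) / 2 := by
    intro n
    rw [hop_add_single, hopCoef_add_single hxy, norm_mul, Complex.norm_real, Real.norm_of_nonneg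
      (by positivity)]
    have := sqrt_mul_le_of_sq_le (s := n x + 1) (t := n y + 1) (by positivity) (by positivity)
      (hp (n + Pi.single y 1)) (hp (n + Pi.single x 1))
      (hf (n + Pi.single y 1) (n + Pi.single x 1))
    simpa using this
  have hs : Summable fun n : S → ℕ => (hopCoef x y (n + Pi.single x 1) : ℂ) *
        f (hop x y (n + Pi.single x 1)) (n + Pi.single x 1) :=
    Summable.of_norm_bounded hsum.summable hbound
  have hh := (hasSum_add_single_iff (g := fun k => (hopCoef x y k : ℂ) * f (hop x y k) k)
    (x := x) (fun k hk => by simp [hopCoef_eq_zero hk])).1 hs.hasSum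
  refine ⟨hh.summable, ?_⟩
  rw [hopExp, hh.tsum_eq]
  exact tsum_of_norm_bounded hsum hbound

variable [Fintype S]

open scoped Classical in
/-- `tr(f H)` in terms of the hopping expectations and the moments of the occupation numbers. -/
def totalEnergy (G : SimpleGraph S) (J U μ : ℝ) (f : (S → ℕ) → (S → ℕ) → ℂ) (p : (S → ℕ) → ℝ) : ℝ :=
  -J * (∑ x, ∑ y, if G.Adj x y then (hopExp x y f).re else 0)
    + ∑' k, diagEnergy U μ k * p k

theorem hasSum_energy (G : SimpleGraph S) (J U μ : ℝ) {f : (S → ℕ) → (S → ℕ) → ℂ}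
    {p : (S → ℕ) → ℝ} (hp : ∀ k, 0 ≤ p k) (hfp : ∀ k, f k k = p k)
    (hf : ∀ k l, ‖f k l‖ ^ 2 ≤ p k * p l)
    (h2 : ∀ x, Summable fun k : S → ℕ => (k x : ℝ) ^ 2 * p k) :
    HasSum (fun k => (hamiltonianExpr G J U μ (fun l => f l k) k).re)
      (totalEnergy G J U μ f p) := by
  classical
  have h : ∀ x y, HasSum (fun k => if G.Adj x y then
        ((hopCoef x y k : ℂ) * f (hop x y k) k).re else 0)
      (if G.Adj x y then (hopExp x y f).re else 0) := by
    intro x y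
    by_cases hxy : G.Adj x y
    · simp only [if_pos hxy]
      exact Complex.hasSum_re (summable_hop_and_norm_le hxy.ne hp hf
        (Summable.mean_of_sq hp (h2 x)) (Summable.mean_of_sq hp (h2 y))).1.hasSum
    · simpa only [if_neg hxy] using hasSum_zero
  have hs := ((hasSum_sum (s := Finset.univ) fun x _ =>
    hasSum_sum (s := Finset.univ) fun y _ => h x y).mul_left (-J)).add
      (hasSum_diagEnergy U μ hp h2).summable.hasSum
  convert! hs using 1
  funext k
  rw [hamiltonianExpr_apply, hfp, Complex.add_re, ← Complex.ofReal_neg, Complex.re_ofReal_mul,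
    ← Complex.ofReal_mul, Complex.ofReal_re, Complex.re_sum]
  congr 2
  refine Finset.sum_congr rfl fun x _ => ?_
  rw [Complex.re_sum]
  refine Finset.sum_congr rfl fun y _ => ?_
  split_ifs <;> simp

open scoped Classical in
/-- The kinetic energy is bounded below by `-Δ|J| N` if the degrees are at most `Δ`. -/
theorem le_totalEnergy (G : SimpleGraph S) (J U μ : ℝ) {Δ : ℝ}
    (hΔ : ∀ x, (∑ y, if G.Adj x y then (1 : ℝ) else 0) ≤ Δ) {f : (S → ℕ) → (S → ℕ) → ℂ}
    {p : (S → ℕ) → ℝ} (hp : ∀ k, 0 ≤ p k) (hp1 : HasSum p 1)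
    (hf : ∀ k l, ‖f k l‖ ^ 2 ≤ p k * p l)
    (h2 : ∀ x, Summable fun k : S → ℕ => (k x : ℝ) ^ 2 * p k) (hU : 0 ≤ U) :
    ∑ x, (U / 2 * (mean x p ^ 2 - mean x p) - (Δ * |J| + μ) * mean x p) ≤
      totalEnergy G J U μ f p := by
  have hm0 : ∀ x, 0 ≤ mean x p := fun x => tsum_nonneg fun k => mul_nonneg (Nat.cast_nonneg _) (hp k)
  have hkin : |J * (∑ x, ∑ y, if G.Adj x y then (hopExp x y f).re else 0)| ≤
      |J| * (Δ * ∑ x, mean x p) := by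
    rw [abs_mul]
    refine mul_le_mul_of_nonneg_left ?_ (abs_nonneg J)
    refine (Finset.abs_sum_le_sum_abs _ _).trans (le_trans (Finset.sum_le_sum fun x _ => ?_)
      (sum_adj_mean_le G hΔ hm0))
    refine (Finset.abs_sum_le_sum_abs _ _).trans (Finset.sum_le_sum fun y _ => ?_)
    split_ifs with hxy
    · exact (Complex.abs_re_le_norm _).trans (summable_hop_and_norm_le hxy.ne hp hf
        (Summable.mean_of_sq hp (h2 x)) (Summable.mean_of_sq hp (h2 y))).2
    · simp
  rw [totalEnergy, (hasSum_diagEnergy U μ hp h2).tsum_eq]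
  -- Since `U ≥ 0`, the second moment may be replaced by the smaller squared mean.
  have hdiag : ∑ x, (U / 2 * (mean x p ^ 2 - mean x p) - μ * mean x p) ≤
      ∑ x, (U / 2 * ((∑' k : S → ℕ, (k x : ℝ) ^ 2 * p k) - mean x p) - μ * mean x p) := by
    refine Finset.sum_le_sum fun x _ => ?_
    have := sq_mean_le hp hp1 (h2 x)
    gcongr
  have hsplit : ∑ x, (U / 2 * (mean x p ^ 2 - mean x p) - (Δ * |J| + μ) * mean x p) =
      ∑ x, (U / 2 * (mean x p ^ 2 - mean x p) - μ * mean x p) - |J| * (Δ * ∑ x, mean x p) := by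
    rw [Finset.mul_sum, Finset.mul_sum, ← Finset.sum_sub_distrib]
    refine Finset.sum_congr rfl fun x _ => ?_
    ring
  have := (abs_le.1 hkin).2
  linarith

end Energy

/-! ### The Gibbs state -/

section Positive

variable {κ ι : Type} (b : HilbertBasis ι ℂ (L2 κ))

theorem hasSum_entry_self {T : L2 κ →L[ℂ] L2 κ} {r : ι → ℝ}
    (hT : ∀ i, T (b i) = (r i : ℂ) • b i) (k : κ) :
    HasSum (fun i => r i * ‖b i k‖ ^ 2) (entry T k k).re := by
  convert! Complex.hasSum_re (hasSum_entry b hT k k) using 1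
  funext i
  rw [Complex.mul_conj, Complex.normSq_eq_norm_sq, ← Complex.ofReal_mul, Complex.ofReal_re]

theorem conj_entry {T : L2 κ →L[ℂ] L2 κ} {r : ι → ℝ}
    (hT : ∀ i, T (b i) = (r i : ℂ) • b i) (k l : κ) : conj (entry T k l) = entry T l k := by
  have h := (hasSum_entry b hT k l).map (starRingEnd ℂ) Complex.continuous_conj
  refine h.unique ?_
  convert! hasSum_entry b hT l k using 1
  funext i
  simp [mul_comm]

theorem entry_self {T : L2 κ →L[ℂ] L2 κ} {r : ι → ℝ}
    (hT : ∀ i, T (b i) = (r i : ℂ) • b i) (k : κ) : entry T k k = ((entry T k k).re : ℂ) :=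
  (Complex.conj_eq_iff_re.1 (conj_entry b hT k k)).symm

theorem entry_self_nonneg {T : L2 κ →L[ℂ] L2 κ} {r : ι → ℝ} (hr : ∀ i, 0 ≤ r i)
    (hT : ∀ i, T (b i) = (r i : ℂ) • b i) (k : κ) : 0 ≤ (entry T k k).re :=
  (hasSum_entry_self b hT k).nonneg fun i => mul_nonneg (hr i) (sq_nonneg _)

/-- Cauchy–Schwarz for a positive semidefinite matrix, proved on finite partial sums with each
weight `r i` split as √r · √r. -/
theorem norm_entry_sq_le {T : L2 κ →L[ℂ] L2 κ} {r : ι → ℝ} (hr : ∀ i, 0 ≤ r i)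
    (hT : ∀ i, T (b i) = (r i : ℂ) • b i) (k l : κ) :
    ‖entry T k l‖ ^ 2 ≤ (entry T k k).re * (entry T l l).re := by
  have h := (hasSum_entry b hT k l).norm.pow 2
  refine le_of_tendsto h (Filter.Eventually.of_forall fun s => ?_)
  have h1 : ‖∑ i ∈ s, (r i : ℂ) * (b i k * conj (b i l))‖ ≤
      ∑ i ∈ s, (√(r i) * ‖b i k‖) * (√(r i) * ‖b i l‖) := by
    refine (norm_sum_le _ _).trans (Finset.sum_le_sum fun i _ => ?_)
    rw [norm_mul, norm_mul, Complex.norm_real, RCLike.norm_conj, Real.norm_of_nonneg (hr i)]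
    refine le_of_eq ?_
    calc r i * (‖b i k‖ * ‖b i l‖) = (√(r i) * √(r i)) * (‖b i k‖ * ‖b i l‖) := by
          rw [Real.mul_self_sqrt (hr i)]
      _ = _ := by ring
  have h2 : ∀ m, ∑ i ∈ s, (√(r i) * ‖b i m‖) ^ 2 ≤ (entry T m m).re := by
    intro m
    have h3 := sum_le_hasSum s (fun i _ => mul_nonneg (hr i) (sq_nonneg ‖b i m‖))
      (hasSum_entry_self b hT m)
    refine le_trans (le_of_eq (Finset.sum_congr rfl fun i _ => ?_)) h3
    rw [mul_pow, Real.sq_sqrt (hr i)]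
  calc ‖∑ i ∈ s, (r i : ℂ) * (b i k * conj (b i l))‖ ^ 2
      ≤ (∑ i ∈ s, (√(r i) * ‖b i k‖) * (√(r i) * ‖b i l‖)) ^ 2 := by gcongr
    _ ≤ (∑ i ∈ s, (√(r i) * ‖b i k‖) ^ 2) * ∑ i ∈ s, (√(r i) * ‖b i l‖) ^ 2 :=
        Finset.sum_mul_sq_le_sq_mul_sq _ _ _
    _ ≤ _ := mul_le_mul (h2 k) (h2 l) (Finset.sum_nonneg fun i _ => sq_nonneg _)
        (entry_self_nonneg b hr hT k)

theorem hasSum_entry_self_trace {T : L2 κ →L[ℂ] L2 κ} {r : ι → ℝ} (hr : ∀ i, 0 ≤ r i)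
    (hT : ∀ i, T (b i) = (r i : ℂ) • b i) {a : ℝ} (ha : 0 ≤ a) :
    HasSum (fun k => (entry T k k).re) a ↔ HasSum r a := by
  have h := posTrace_eq_tsum b hr hT
  rw [posTrace_eq_entry] at h
  have key : ∀ {α : Type} {g : α → ℝ}, (∀ i, 0 ≤ g i) →
      (HasSum g a ↔ ∑' i, ENNReal.ofReal (g i) = ENNReal.ofReal a) := by
    intro α g hg
    constructor
    · intro h
      rw [← ENNReal.ofReal_tsum_of_nonneg hg h.summable, h.tsum_eq]
    · intro h
      have hs : Summable g := by
        have := ENNReal.summable_toReal (h.trans_ne ENNReal.ofReal_ne_top)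
        simpa only [ENNReal.toReal_ofReal (hg _)] using this
      rw [← ENNReal.ofReal_tsum_of_nonneg hg hs,
        ENNReal.ofReal_eq_ofReal_iff (tsum_nonneg hg) ha] at h
      exact h ▸ hs.hasSum
  rw [key (entry_self_nonneg b hr hT), key hr, h]

end Positive

/-! ### Number-conserving eigenbases of H; existence and uniqueness of the Gibbs state -/

section Eigenbasis

variable {S : Type} [Fintype S] [DecidableEq S]

/-- `b` is an eigenbasis of the Hamiltonian that respects the particle number. -/
structure IsEigenbasis (G : SimpleGraph S) (J U μ : ℝ) (b : HilbertBasis (S → ℕ) ℂ (Fock S))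
    (ε : (S → ℕ) → ℝ) : Prop where
  support : ∀ i k, deg k ≠ deg i → b i k = 0
  eigen : ∀ i k, hamiltonianExpr G J U μ (b i) k = ε i * b i k

theorem exists_isEigenbasis (G : SimpleGraph S) (J U μ : ℝ) :
    ∃ b ε, IsEigenbasis G J U μ b ε := by
  obtain ⟨b, ε, h1, h2⟩ := exists_graded_eigenbasis (deg : (S → ℕ) → ℕ) (sector S) mem_sector
    (fun k l => (hMat G J U μ k l : ℂ)) (fun k l => by rw [Complex.conj_ofReal, hMat_symm])
  refine ⟨b, ε, h1, fun i k => ?_⟩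
  rw [hamiltonianExpr_eq_sum]
  by_cases h : deg k = deg i
  · rw [h]
    exact h2 i k h
  · rw [h1 i k h, mul_zero]
    refine Finset.sum_eq_zero fun l hl => ?_
    rw [h1 i l, mul_zero]
    rwa [(mem_sector _ _).1 hl]

variable {G : SimpleGraph S} {J U μ : ℝ} {b : HilbertBasis (S → ℕ) ℂ (Fock S)}
  {ε : (S → ℕ) → ℝ}

theorem IsEigenbasis.notMem (hb : IsEigenbasis G J U μ b ε) {i k : S → ℕ}
    (h : k ∉ sector S (deg i)) : b i k = 0 :=
  hb.support i k fun h' => h ((mem_sector _ _).2 h')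

/-- Symmetry of H tested against `b i`: both `e ⟨b i, ψ⟩` and `ε i ⟨b i, ψ⟩` equal the same double
sum. It is finite because `b i` is finitely supported, so `ψ` may be any vector of the maximal
domain. -/
theorem IsEigenbasis.eq_of_inner_ne_zero (hb : IsEigenbasis G J U μ b ε) {ψ : Fock S} {e : ℝ}
    (hψ : ∀ k, hamiltonianExpr G J U μ ψ k = e * ψ k) {i : S → ℕ} (hi : ⟪b i, ψ⟫_ℂ ≠ 0) :
    ε i = e := by
  have hsum := inner_eq_sum_of_support (s := sector S (deg i)) (fun k hk => hb.notMem hk) ψ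
  have h1 : (e : ℂ) * ⟪b i, ψ⟫_ℂ = ∑ k ∈ sector S (deg i), ∑ l ∈ sector S (deg i),
      conj (b i k) * ((hMat G J U μ k l : ℂ) * ψ l) := by
    rw [hsum, Finset.mul_sum]
    refine Finset.sum_congr rfl fun k hk => ?_
    rw [← Finset.mul_sum, ← (mem_sector _ _).1 hk, ← hamiltonianExpr_eq_sum, hψ]
    ring
  have h2 : (ε i : ℂ) * ⟪b i, ψ⟫_ℂ = ∑ l ∈ sector S (deg i), ∑ k ∈ sector S (deg i),
      conj (b i k) * ((hMat G J U μ k l : ℂ) * ψ l) := by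
    rw [hsum, Finset.mul_sum]
    refine Finset.sum_congr rfl fun l hl => ?_
    have h3 := congrArg conj (hb.eigen i l)
    rw [hamiltonianExpr_eq_sum, (mem_sector _ _).1 hl, map_sum, map_mul, Complex.conj_ofReal] at h3
    rw [← mul_assoc, ← h3, Finset.sum_mul]
    refine Finset.sum_congr rfl fun k _ => ?_
    rw [map_mul, Complex.conj_ofReal, hMat_symm]
    ring
  rw [Finset.sum_comm, ← h1] at h2
  exact_mod_cast mul_right_cancel₀ hi h2

theorem IsEigenbasis.apply_eq (hb : IsEigenbasis G J U μ b ε) {T : Fock S →L[ℂ] Fock S}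
    {g : ℝ → ℂ} (hT : ∀ i, T (b i) = g (ε i) • b i) {ψ : Fock S} {e : ℝ}
    (hψ : ∀ k, hamiltonianExpr G J U μ ψ k = e * ψ k) : T ψ = g e • ψ :=
  apply_eq_of_inner_ne_zero b hT ψ _ fun _ hi => by rw [hb.eq_of_inner_ne_zero hψ hi]

/-- The zero-particle sector is spanned by the vacuum, which H annihilates. This is what gives Z ≥
1. -/
theorem IsEigenbasis.eigenvalue_zero (hb : IsEigenbasis G J U μ b ε) : ε 0 = 0 := by
  have hsec : sector S (deg (0 : S → ℕ)) = {0} := by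
    ext k
    rw [mem_sector, Finset.mem_singleton]
    simp [deg, funext_iff]
  have h0 : b 0 0 ≠ 0 := by
    intro h
    refine b.orthonormal.ne_zero 0 (lp.ext (funext fun k => ?_))
    by_cases hk : k = 0
    · rw [hk, h]
      rfl
    · exact hb.notMem (by rw [hsec]; simpa using hk)
  have h1 := hb.eigen 0 0
  have h2 : hMat G J U μ (0 : S → ℕ) 0 = 0 := by
    simp [hMat, hopCoef, diagEnergy]
  rw [hamiltonianExpr_eq_sum, hsec, Finset.sum_singleton, h2] at h1
  have h3 : (ε 0 : ℂ) * b 0 0 = 0 := by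
    rw [← h1]
    simp
  exact_mod_cast (mul_eq_zero.1 h3).resolve_right h0

open scoped Classical in
/-- The energies grow faster than any multiple of the particle number. -/
theorem IsEigenbasis.exists_le_eigenvalue (hb : IsEigenbasis G J U μ b ε) (hU : 0 < U) (c : ℝ) :
    ∃ C : ℝ, ∀ i, c * deg i - C ≤ ε i := by
  -- Any finite bound on the degrees will do here, so the sum of all of them is taken.
  let Δ : ℝ := ∑ x : S, ∑ y, if G.Adj x y then (1 : ℝ) else 0
  have hΔ : ∀ x, (∑ y, if G.Adj x y then (1 : ℝ) else 0) ≤ Δ := fun x =>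
    Finset.single_le_sum (f := fun x => ∑ y, if G.Adj x y then (1 : ℝ) else 0)
      (fun x _ => Finset.sum_nonneg fun y _ => by split_ifs <;> norm_num) (Finset.mem_univ x)
  -- Collects the coefficients of the linear terms in the mean; completing the square gives (U/2)m²
  -- - am ≥ -a²/(2U) at each site.
  set a : ℝ := U / 2 + (Δ * |J| + μ) + c with ha
  refine ⟨∑ x : S, a ^ 2 / (2 * U), fun i => ?_⟩
  let p : (S → ℕ) → ℝ := fun k => ‖b i k‖ ^ 2
  -- The rank-one projection onto `b i`, whose energy is `ε i`.
  let f : (S → ℕ) → (S → ℕ) → ℂ := fun k l => b i k * conj (b i l)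
  have hp : ∀ k, 0 ≤ p k := fun k => sq_nonneg _
  have hp1 : HasSum p 1 := hasSum_norm_sq_basis b i
  have hfin : ∀ (g : (S → ℕ) → ℝ), Summable fun k => g k * p k := fun g =>
    summable_of_ne_finset_zero (s := sector S (deg i)) fun k hk => by simp [p, hb.notMem hk]
  have hf : ∀ k l, ‖f k l‖ ^ 2 ≤ p k * p l := fun k l => by
    simp [f, p, mul_pow]
  have hfp : ∀ k, f k k = p k := fun k => by
    simp only [f, p, Complex.mul_conj, Complex.normSq_eq_norm_sq]
  have hE : totalEnergy G J U μ f p = ε i := by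
    refine (hasSum_energy G J U μ hp hfp hf fun x => hfin _).unique ?_
    convert! hp1.mul_left (ε i) using 1
    · funext k
      have : (fun l => f l k) = conj (b i k) • (b i : (S → ℕ) → ℂ) := by
        funext l
        simp [f, mul_comm]
      rw [this, map_smul, Pi.smul_apply, smul_eq_mul, hb.eigen, mul_left_comm, mul_comm (conj _),
        Complex.mul_conj, Complex.normSq_eq_norm_sq, ← Complex.ofReal_mul, Complex.ofReal_re]
    · simp
  have hdeg : ∑ x, mean x p = deg i := by
    have h1 : HasSum (fun k => ∑ x, (k x : ℝ) * p k) (∑ x, mean x p) :=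
      hasSum_sum fun x _ => (hfin fun k => (k x : ℝ)).hasSum
    refine h1.unique ?_
    convert! hp1.mul_left (deg i : ℝ) using 1
    · funext k
      rw [← Finset.sum_mul]
      by_cases h : deg k = deg i
      · rw [← h, deg]
        push_cast
        rfl
      · simp [p, hb.support i k h]
    · simp
  have hle := le_totalEnergy G J U μ hΔ hp hp1 hf (fun x => hfin _) hU.le
  rw [hE] at hle
  refine le_trans ?_ hle
  rw [← hdeg, Finset.mul_sum, ← Finset.sum_sub_distrib]
  refine Finset.sum_le_sum fun x _ => ?_
  have hsq : 0 ≤ U / 2 * (mean x p - a / U) ^ 2 := by positivity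
  have hexp : U / 2 * (mean x p - a / U) ^ 2 =
      U / 2 * mean x p ^ 2 - a * mean x p + a ^ 2 / (2 * U) := by
    field_simp
    ring
  rw [hexp] at hsq
  rw [ha] at hsq ⊢
  linarith

/-- Linear growth of the energies with slope 3/β. The exponent 3 leaves e^(-N) summable after
squared occupation numbers are absorbed into e^(2N). -/
theorem IsEigenbasis.exists_exp_le (hb : IsEigenbasis G J U μ b ε) (hU : 0 < U) {β : ℝ}
    (hβ : 0 < β) : ∃ C : ℝ, 0 < C ∧ ∀ i, Real.exp (-β * ε i) ≤ C * Real.exp (-(3 * deg i)) := by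
  obtain ⟨C, hC⟩ := hb.exists_le_eigenvalue hU (3 / β)
  refine ⟨Real.exp (β * C), Real.exp_pos _, fun i => ?_⟩
  rw [← Real.exp_add, Real.exp_le_exp]
  have := mul_le_mul_of_nonneg_left (hC i) hβ.le
  have h2 : β * (3 / β * deg i - C) = 3 * deg i - β * C := by field_simp
  linarith

theorem IsEigenbasis.summable_exp (hb : IsEigenbasis G J U μ b ε) (hU : 0 < U) {β : ℝ}
    (hβ : 0 < β) : Summable fun i => Real.exp (-β * ε i) := by
  obtain ⟨C, hC0, hC⟩ := hb.exists_exp_le hU hβ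
  refine Summable.of_nonneg_of_le (fun i => (Real.exp_pos _).le) (fun i => (hC i).trans ?_)
    (summable_exp_neg_deg.mul_left C)
  gcongr
  have : (0 : ℝ) ≤ deg i := Nat.cast_nonneg _
  linarith

theorem IsEigenbasis.isHeatOperator (hb : IsEigenbasis G J U μ b ε) {β : ℝ}
    {T : Fock S →L[ℂ] Fock S} (hT : ∀ i, T (b i) = (Real.exp (-β * ε i) : ℂ) • b i) :
    IsHeatOperator (hamiltonian G J U μ) β T := by
  refine ⟨_, b, ε, fun i => ⟨?_, hT i⟩⟩
  have heq : hamiltonianExpr G J U μ (b i) = ((ε i : ℂ) • b i : Fock S) := by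
    funext k
    exact hb.eigen i k
  refine ⟨?_, ?_⟩
  · change Memℓp (hamiltonianExpr G J U μ (b i)) 2
    rw [heq]
    exact lp.memℓp _
  · exact lp.ext heq

theorem exists_isGibbsState (G : SimpleGraph S) (J U μ : ℝ) (hU : 0 < U) {β : ℝ} (hβ : 0 < β) :
    ∃ ρ, IsGibbsState (hamiltonian G J U μ) β ρ := by
  obtain ⟨b, ε, hb⟩ := exists_isEigenbasis G J U μ
  have hs := hb.summable_exp hU hβ
  obtain ⟨T, hT⟩ := exists_diagonal b hs
  refine ⟨_, T, hb.isHeatOperator hT, ?_, rfl⟩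
  rw [posTrace_eq_tsum b (fun i => (Real.exp_pos _).le) hT,
    ← ENNReal.ofReal_tsum_of_nonneg (fun i => (Real.exp_pos _).le) hs]
  exact ENNReal.ofReal_ne_top

/-- Every Gibbs state is diagonal in every eigenbasis that respects the particle number. -/
theorem IsEigenbasis.gibbs (hb : IsEigenbasis G J U μ b ε) (hU : 0 < U) {β : ℝ} (hβ : 0 < β)
    {ρ : Fock S →L[ℂ] Fock S} (hρ : IsGibbsState (hamiltonian G J U μ) β ρ) :
    ∃ Z : ℝ, 1 ≤ Z ∧ HasSum (fun i => Real.exp (-β * ε i)) Z ∧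
      ∀ i, ρ (b i) = ((Real.exp (-β * ε i) / Z : ℝ) : ℂ) • b i := by
  have hs := hb.summable_exp hU hβ
  obtain ⟨T, hT⟩ := exists_diagonal b hs
  obtain ⟨T', ⟨ι, b', ε', h'⟩, -, rfl⟩ := hρ
  -- The eigenvectors witnessing `T'` solve the eigenvalue equation of H, and on such vectors `T` is
  -- forced to act by the same exponential. So the heat operator does not depend on the eigenbasis.
  have hTT : T' = T := by
    refine clm_ext_of_basis b' fun j => ?_
    obtain ⟨⟨hdom, hH⟩, hT'⟩ := h' j
    rw [hT', hb.apply_eq (g := fun e => (Real.exp (-β * e) : ℂ)) hT (e := ε' j)]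
    intro k
    exact congrArg (fun φ : Fock S => φ k) hH
  subst hTT
  have htr : (posTrace T').toReal = ∑' i, Real.exp (-β * ε i) := by
    rw [posTrace_eq_tsum b (fun i => (Real.exp_pos _).le) hT,
      ← ENNReal.ofReal_tsum_of_nonneg (fun i => (Real.exp_pos _).le) hs,
      ENNReal.toReal_ofReal (tsum_nonneg fun i => (Real.exp_pos _).le)]
  refine ⟨_, ?_, hs.hasSum, fun i => ?_⟩
  · have := le_hasSum hs.hasSum 0 fun i _ => (Real.exp_pos _).le
    simpa [hb.eigenvalue_zero] using this
  · rw [smul_apply, hT, htr, smul_smul, ← Complex.ofReal_mul]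
    congr 2
    rw [div_eq_mul_inv, mul_comm]

end Eigenbasis

/-! ### Traces over sectors -/

section SectorTrace

variable {S : Type} [Fintype S] [DecidableEq S]

theorem hasSum_fiber (F : (S → ℕ) → ℝ) (N : ℕ) :
    HasSum (fun k : {k : S → ℕ // deg k = N} => F k) (∑ k ∈ sector S N, F k) := by
  have h := (sector S N).hasSum F
  exact (Equiv.subtypeEquivRight fun k => (mem_sector N k).symm :
    {k : S → ℕ // deg k = N} ≃ {k // k ∈ sector S N}).hasSum_iff.2 h

/-- Nonnegativity turns summability of the sector sums into summability of `F`; the comparison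
function `H` may have any sign. -/
theorem hasSum_of_sector_sum_eq {F H : (S → ℕ) → ℝ} (hF : ∀ k, 0 ≤ F k) {a : ℝ} (hH : HasSum H a)
    (h : ∀ N, ∑ k ∈ sector S N, F k = ∑ k ∈ sector S N, H k) : HasSum F a := by
  let e := Equiv.sigmaFiberEquiv (deg : (S → ℕ) → ℕ)
  have h1 : HasSum (fun N => ∑ k ∈ sector S N, H k) a :=
    (e.hasSum_iff.2 hH).sigma fun N => hasSum_fiber H N
  have h2 : Summable (F ∘ e) := by
    refine (summable_sigma_of_nonneg fun x => hF _).2 ⟨fun N => (hasSum_fiber F N).summable, ?_⟩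
    refine h1.summable.congr fun N => ?_
    rw [← h N]
    exact (hasSum_fiber F N).tsum_eq.symm
  have h3 : HasSum (fun N => ∑ k ∈ sector S N, F k) (∑' x, (F ∘ e) x) :=
    h2.hasSum.sigma fun N => hasSum_fiber F N
  simp only [h] at h3
  have h4 := h2.hasSum
  rw [h3.unique h1] at h4
  exact e.hasSum_iff.1 h4

variable {G : SimpleGraph S} {J U μ : ℝ} {b : HilbertBasis (S → ℕ) ℂ (Fock S)}
  {ε : (S → ℕ) → ℝ}

theorem IsEigenbasis.sum_sector (hb : IsEigenbasis G J U μ b ε) {N : ℕ} {k : S → ℕ}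
    (hk : deg k = N) (l : S → ℕ) :
    ∑ i ∈ sector S N, b i k * conj (b i l) = if k = l then 1 else 0 := by
  refine HasSum.unique ?_ (hasSum_conj_mul_apply b k l)
  refine hasSum_sum_of_ne_finset_zero fun i hi => ?_
  rw [hb.support i k, zero_mul]
  rw [hk]
  exact fun h => hi ((mem_sector _ _).2 h.symm)

/-- Spectral decomposition of one block: replace `ε i * b i k` by (H b_i)(k) and use completeness
within the sector. -/
theorem IsEigenbasis.sum_sector_eigenvalue (hb : IsEigenbasis G J U μ b ε) {N : ℕ} {k l : S → ℕ}
    (hk : deg k = N) (hl : deg l = N) :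
    ∑ i ∈ sector S N, ε i * (b i k * conj (b i l)) = hMat G J U μ k l := by
  have h1 : ∀ i ∈ sector S N, ε i * (b i k * conj (b i l)) =
      ∑ m ∈ sector S N, (hMat G J U μ k m : ℂ) * (b i m * conj (b i l)) := by
    intro i _
    rw [← mul_assoc, ← hb.eigen, hamiltonianExpr_eq_sum, hk, Finset.sum_mul]
    exact Finset.sum_congr rfl fun m _ => by ring
  rw [Finset.sum_congr rfl h1, Finset.sum_comm]
  have h2 : ∀ m ∈ sector S N, ∑ i ∈ sector S N, (hMat G J U μ k m : ℂ) * (b i m * conj (b i l)) =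
      if m = l then (hMat G J U μ k m : ℂ) else 0 := by
    intro m hm
    rw [← Finset.mul_sum, hb.sum_sector ((mem_sector _ _).1 hm)]
    split_ifs <;> simp
  rw [Finset.sum_congr rfl h2, Finset.sum_ite_eq', if_pos ((mem_sector _ _).2 hl)]

/-- The expectation `⟨ψ, f ψ⟩` of a matrix in a vector supported on the `N`-particle sector. -/
def sectorForm (f : (S → ℕ) → (S → ℕ) → ℂ) (N : ℕ) (ψ : (S → ℕ) → ℂ) : ℂ :=
  ∑ k ∈ sector S N, ∑ l ∈ sector S N, f l k * (ψ k * conj (ψ l))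

/-- `tr(f (βH + c))` computed in an eigenbasis of `H`. -/
theorem IsEigenbasis.hasSum_trace (hb : IsEigenbasis G J U μ b ε) {β c : ℝ}
    (hc : ∀ i, 0 ≤ β * ε i + c) {f : (S → ℕ) → (S → ℕ) → ℂ} {p : (S → ℕ) → ℝ}
    (hp : ∀ k, 0 ≤ p k) (hp1 : HasSum p 1) (hfp : ∀ k, f k k = p k)
    (hf : ∀ k l, ‖f k l‖ ^ 2 ≤ p k * p l)
    (h2 : ∀ x, Summable fun k : S → ℕ => (k x : ℝ) ^ 2 * p k)
    (hq : ∀ i, 0 ≤ (sectorForm f (deg i) (b i)).re) :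
    HasSum (fun i => (β * ε i + c) * (sectorForm f (deg i) (b i)).re)
      (β * totalEnergy G J U μ f p + c) := by
  have hE := (hasSum_energy G J U μ hp hfp hf h2).mul_left β
  have hH := hE.add (hp1.mul_left c)
  rw [mul_one] at hH
  -- The left side is nonnegative thanks to the shift `c`, so the eigenbasis and the occupation
  -- basis need only be compared sector by sector, which is finite linear algebra.
  refine hasSum_of_sector_sum_eq (fun i => mul_nonneg (hc i) (hq i)) hH fun N => ?_
  have hmain : ∑ i ∈ sector S N, ((β * ε i + c : ℝ) : ℂ) * sectorForm f N (b i) =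
      ∑ k ∈ sector S N, (β * hamiltonianExpr G J U μ (fun l => f l k) k + c * p k) := by
    have h1 : ∀ i, ((β * ε i + c : ℝ) : ℂ) * sectorForm f N (b i) =
        ∑ k ∈ sector S N, ∑ l ∈ sector S N,
          (β * f l k * (ε i * (b i k * conj (b i l))) + c * f l k * (b i k * conj (b i l))) := by
      intro i
      rw [sectorForm, Finset.mul_sum]
      refine Finset.sum_congr rfl fun k _ => ?_
      rw [Finset.mul_sum]
      refine Finset.sum_congr rfl fun l _ => ?_
      push_cast
      ring
    simp only [h1]
    rw [Finset.sum_comm]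
    refine Finset.sum_congr rfl fun k hk => ?_
    rw [Finset.sum_comm]
    have hk' := (mem_sector _ _).1 hk
    have h3 : ∀ l ∈ sector S N, ∑ i ∈ sector S N,
        (β * f l k * (ε i * (b i k * conj (b i l))) + c * f l k * (b i k * conj (b i l))) =
        β * (hMat G J U μ k l * f l k) + if k = l then (c : ℂ) * f l k else 0 := by
      intro l hl
      rw [Finset.sum_add_distrib, ← Finset.mul_sum, ← Finset.mul_sum,
        hb.sum_sector_eigenvalue hk' ((mem_sector _ _).1 hl), hb.sum_sector hk']
      split_ifs <;> ring
    rw [Finset.sum_congr rfl h3, Finset.sum_add_distrib, ← Finset.mul_sum, Finset.sum_ite_eq,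
      if_pos hk, hfp, hamiltonianExpr_eq_sum, hk']
  have := congrArg Complex.re hmain
  rw [Complex.re_sum, Complex.re_sum] at this
  refine Eq.trans (Finset.sum_congr rfl fun i hi => ?_) (this.trans ?_)
  · rw [(mem_sector _ _).1 hi, Complex.re_ofReal_mul]
  · refine Finset.sum_congr rfl fun k _ => ?_
    rw [Complex.add_re, Complex.re_ofReal_mul, Complex.re_ofReal_mul, Complex.ofReal_re]

end SectorTrace

/-! ### Density matrices with exponentially decaying diagonal -/

section Density

variable {S : Type} [Fintype S]

/-- `ρ` is a density matrix, diagonal in the number-conserving basis `b` with weights `r`, whose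
diagonal entries decay exponentially in the particle number. -/
structure IsDensity (ρ : Fock S →L[ℂ] Fock S) (b : HilbertBasis (S → ℕ) ℂ (Fock S))
    (r : (S → ℕ) → ℝ) : Prop where
  support : ∀ i k, deg k ≠ deg i → b i k = 0
  apply : ∀ i, ρ (b i) = (r i : ℂ) • b i
  nonneg : ∀ i, 0 ≤ r i
  trace : HasSum r 1
  decay : ∃ C : ℝ, ∀ k, (entry ρ k k).re ≤ C * Real.exp (-(3 * deg k))

/-- The diagonal entries of a density matrix. -/
def diag {κ : Type} (ρ : L2 κ →L[ℂ] L2 κ) (k : κ) : ℝ := (entry ρ k k).re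

variable {ρ : Fock S →L[ℂ] Fock S} {b : HilbertBasis (S → ℕ) ℂ (Fock S)} {r : (S → ℕ) → ℝ}

theorem IsDensity.diag_nonneg (h : IsDensity ρ b r) (k : S → ℕ) : 0 ≤ diag ρ k :=
  entry_self_nonneg b h.nonneg h.apply k

theorem IsDensity.hasSum_diag (h : IsDensity ρ b r) : HasSum (diag ρ) 1 :=
  (hasSum_entry_self_trace b h.nonneg h.apply zero_le_one).2 h.trace

theorem IsDensity.entry_self (h : IsDensity ρ b r) (k : S → ℕ) : entry ρ k k = diag ρ k :=
  BoseHubbard.entry_self b h.apply k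

theorem IsDensity.norm_entry_sq_le (h : IsDensity ρ b r) (k l : S → ℕ) :
    ‖entry ρ k l‖ ^ 2 ≤ diag ρ k * diag ρ l :=
  BoseHubbard.norm_entry_sq_le b h.nonneg h.apply k l

theorem IsDensity.entry_eq_zero (h : IsDensity ρ b r) {k l : S → ℕ} (hkl : deg k ≠ deg l) :
    entry ρ k l = 0 := by
  refine (hasSum_entry b h.apply k l).unique ?_
  convert! (hasSum_zero : HasSum (fun _ : S → ℕ => (0 : ℂ)) 0) using 1
  funext i
  by_cases hk : deg k = deg i
  · have : deg l ≠ deg i := fun h' => hkl (hk.trans h'.symm)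
    simp [h.support i l this]
  · simp [h.support i k hk]

theorem sq_le_exp_two_mul {t : ℝ} (ht : 0 ≤ t) : t ^ 2 ≤ Real.exp (2 * t) := by
  have h1 : t ≤ Real.exp t := by linarith [Real.add_one_le_exp t]
  calc t ^ 2 ≤ Real.exp t ^ 2 := by gcongr
    _ = Real.exp (2 * t) := by rw [← Real.exp_nat_mul]; simp

/-- Bound k_x² by e^(2N) and the diagonal by C e^(-3N), which leaves e^(-N). -/
theorem IsDensity.summable_sq (h : IsDensity ρ b r) (x : S) :
    Summable fun k : S → ℕ => (k x : ℝ) ^ 2 * diag ρ k := by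
  obtain ⟨C, hC⟩ := h.decay
  refine Summable.of_nonneg_of_le (fun k => mul_nonneg (sq_nonneg _) (h.diag_nonneg k))
    (fun k => ?_) ((summable_exp_neg_deg (S := S)).mul_left C)
  have h1 : (k x : ℝ) ^ 2 ≤ Real.exp (2 * deg k) := by
    have h2 : (k x : ℝ) ≤ deg k := by exact_mod_cast le_deg k x
    calc (k x : ℝ) ^ 2 ≤ (deg k : ℝ) ^ 2 := by gcongr
      _ ≤ _ := sq_le_exp_two_mul (Nat.cast_nonneg _)
  calc (k x : ℝ) ^ 2 * diag ρ k
      ≤ Real.exp (2 * deg k) * (C * Real.exp (-(3 * deg k))) :=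
        mul_le_mul h1 (hC k) (h.diag_nonneg k) (Real.exp_pos _).le
    _ = C * (Real.exp (2 * deg k) * Real.exp (-(3 * deg k))) := by ring
    _ = C * Real.exp (-(deg k : ℝ)) := by
        rw [← Real.exp_add]
        ring_nf

theorem IsDensity.weight_le_one (h : IsDensity ρ b r) (i : S → ℕ) : r i ≤ 1 :=
  le_hasSum h.trace i fun _ _ => h.nonneg _

theorem IsDensity.entropy_eq (h : IsDensity ρ b r) :
    entropy ρ = ∑' i, ENNReal.ofReal (Real.negMulLog (r i)) :=
  entropy_eq_tsum b h.nonneg h.weight_le_one h.apply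

/-- Entropy is bounded in terms of the mean particle number. -/
theorem IsDensity.entropy_le (h : IsDensity ρ b r) :
    entropy ρ ≤ ENNReal.ofReal (Real.log 2 * (∑ x, (mean x (diag ρ) + 1))) := by
  rw [h.entropy_eq]
  -- Klein's inequality against the geometric product state, diagonal in the occupation basis, whose
  -- negative logarithm is ln 2 · ∑ (k_x + 1).
  refine (tsum_negMulLog_le b (c := (default : HilbertBasis (S → ℕ) ℂ (Fock S)))
    (r := fun k => (1 / 2 : ℝ) ^ (deg k + Fintype.card S)) h.nonneg h.trace
    (fun k => by positivity) hasSum_half_pow_deg le_rfl).trans ?_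
  have hlog2 : 0 ≤ Real.log 2 := Real.log_nonneg one_le_two
  have hket : ∀ k, (default : HilbertBasis (S → ℕ) ℂ (Fock S)) k = ket k := fun k => rfl
  have h1 : ∀ k, ∑' a, ENNReal.ofReal
      (r a * ‖⟪b a, (default : HilbertBasis (S → ℕ) ℂ (Fock S)) k⟫_ℂ‖ ^ 2) =
        ENNReal.ofReal (diag ρ k) := by
    intro k
    simp only [hket, inner_ket_right, RCLike.norm_conj]
    have hs := hasSum_entry_self b h.apply k
    rw [← ENNReal.ofReal_tsum_of_nonneg (fun i => mul_nonneg (h.nonneg i) (sq_nonneg _))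
      hs.summable, hs.tsum_eq, diag]
  have h2 : ∀ k : S → ℕ, -Real.log ((1 / 2 : ℝ) ^ (deg k + Fintype.card S)) =
      Real.log 2 * ∑ x, ((k x : ℝ) + 1) := by
    intro k
    rw [Real.log_pow, one_div, Real.log_inv, Finset.sum_add_distrib, deg]
    push_cast
    simp
    ring
  have h3 : HasSum (fun k : S → ℕ => Real.log 2 * (∑ x, ((k x : ℝ) + 1)) * diag ρ k)
      (Real.log 2 * (∑ x, (mean x (diag ρ) + 1))) := by
    have := (hasSum_sum (s := Finset.univ) fun (x : S) _ =>
      ((Summable.mean_of_sq h.diag_nonneg (h.summable_sq x)).hasSum.add h.hasSum_diag)).mul_left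
        (Real.log 2)
    convert! this using 1
    funext k
    rw [mul_assoc, Finset.sum_mul]
    congr 1
    exact Finset.sum_congr rfl fun x _ => by ring
  simp only [h1, h2]
  have h4 : ∀ k : S → ℕ, 0 ≤ Real.log 2 * ∑ x, ((k x : ℝ) + 1) := fun k => by positivity
  simp only [← ENNReal.ofReal_mul (h4 _)]
  rw [← ENNReal.ofReal_tsum_of_nonneg (fun k => mul_nonneg (h4 k) (h.diag_nonneg k)) h3.summable,
    h3.tsum_eq]

/-- The sector form is ⟨b_i, ρ b_i⟩, since `b i` is supported in its sector. -/
theorem IsDensity.sectorForm_eq [DecidableEq S] (h : IsDensity ρ b r) (i : S → ℕ) :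
    sectorForm (entry ρ) (deg i) (b i) = r i := by
  have hs : ∀ k ∉ sector S (deg i), b i k = 0 := fun k hk =>
    h.support i k fun h' => hk ((mem_sector _ _).2 h')
  have h1 : ⟪b i, ρ (b i)⟫_ℂ = r i := by
    rw [h.apply, inner_smul_right, inner_self_eq_norm_sq_to_K, b.orthonormal.1 i]
    simp
  rw [← h1, inner_eq_sum_of_support hs, sectorForm, Finset.sum_comm]
  refine Finset.sum_congr rfl fun l _ => ?_
  rw [apply_eq_sum_of_support hs, Finset.mul_sum]
  exact Finset.sum_congr rfl fun k _ => by ring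

end Density

/-! ### Invariance and density bound of the Gibbs state -/

section Gibbs

/-- Composition with an injective map. -/
def compL {κ κ' : Type} (f : κ' → κ) (hf : Function.Injective f) : L2 κ →L[ℂ] L2 κ' :=
  LinearMap.mkContinuous
    { toFun := fun ψ => ⟨fun k => ψ (f k), memℓp_gen' (sum_norm_rpow_comp_le _ hf ψ)⟩
      map_add' := fun _ _ => rfl
      map_smul' := fun _ _ => rfl }
    1
    (fun ψ => by
      rw [one_mul]
      exact lp.norm_le_of_forall_sum_le (by norm_num) (norm_nonneg _)
        (sum_norm_rpow_comp_le _ hf ψ))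

theorem compL_apply {κ κ' : Type} (f : κ' → κ) (hf : Function.Injective f) (ψ : L2 κ) (k : κ') :
    compL f hf ψ k = ψ (f k) := rfl

theorem mean_perm {S : Type} {p : (S → ℕ) → ℝ} (π : Equiv.Perm S) (hp : ∀ k, p (k ∘ π) = p k) (x : S) :
    mean (π x) p = mean x p := by
  rw [mean, mean, ← (π.symm.arrowCongr (Equiv.refl ℕ)).tsum_eq fun k => (k x : ℝ) * p k]
  refine tsum_congr fun k => ?_
  have : (π.symm.arrowCongr (Equiv.refl ℕ)) k = k ∘ π := rfl
  rw [this, hp]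
  rfl

variable {S : Type} [Fintype S] [DecidableEq S]

theorem hamiltonianExpr_comp_perm {G : SimpleGraph S} (J U μ : ℝ) (π : Equiv.Perm S)
    (hπ : ∀ x y, G.Adj (π x) (π y) ↔ G.Adj x y) (ψ : (S → ℕ) → ℂ) (k : S → ℕ) :
    hamiltonianExpr G J U μ (fun l => ψ (l ∘ π)) k = hamiltonianExpr G J U μ ψ (k ∘ π) := by
  classical
  have hsingle : ∀ x : S, (Pi.single (π x) 1 : S → ℕ) ∘ π = Pi.single x 1 := by
    intro x
    funext y
    simp [Pi.single_apply]
  have hhop : ∀ x y, hop (π x) (π y) k ∘ π = hop x y (k ∘ π) := by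
    intro x y
    rw [hop, hop, ← hsingle x, ← hsingle y]
    rfl
  rw [hamiltonianExpr_apply, hamiltonianExpr_apply]
  congr 2
  · rw [← Equiv.sum_comp π]
    refine Finset.sum_congr rfl fun x _ => ?_
    rw [← Equiv.sum_comp π]
    refine Finset.sum_congr rfl fun y _ => ?_
    simp only [hπ, hhop]
    rfl
  · rw [diagEnergy, ← Equiv.sum_comp π]
    rfl

variable {G : SimpleGraph S} {J U μ : ℝ} {b : HilbertBasis (S → ℕ) ℂ (Fock S)}
  {ε : (S → ℕ) → ℝ}

/-- A graph automorphism maps solutions of the eigenvalue equation to solutions with the same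
energy, so it commutes with every function of H. -/
theorem IsEigenbasis.diag_comp_perm (hb : IsEigenbasis G J U μ b ε) {T : Fock S →L[ℂ] Fock S}
    {g : ℝ → ℂ} (hT : ∀ i, T (b i) = g (ε i) • b i) (π : Equiv.Perm S)
    (hπ : ∀ x y, G.Adj (π x) (π y) ↔ G.Adj x y) (k : S → ℕ) : diag T (k ∘ π) = diag T k := by
  have hinj : Function.Injective fun k : S → ℕ => k ∘ π := π.surjective.injective_comp_right
  let P : Fock S →L[ℂ] Fock S := compL (fun k : S → ℕ => k ∘ π) hinj
  have hcomm : T ∘L P = P ∘L T := by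
    refine clm_ext_of_basis b fun i => ?_
    rw [ContinuousLinearMap.comp_apply, ContinuousLinearMap.comp_apply, hT, map_smul]
    refine hb.apply_eq hT fun l => ?_
    exact (hamiltonianExpr_comp_perm J U μ π hπ (b i) l).trans (hb.eigen i _)
  have hket : P (ket (k ∘ π)) = ket k := by
    classical
    ext l
    rw [compL_apply, ket_apply, ket_apply]
    simp only [hinj.eq_iff]
    congr
  have h := congrArg (fun A : Fock S →L[ℂ] Fock S => A (ket (k ∘ π)) k) hcomm
  simp only [ContinuousLinearMap.comp_apply, hket] at h
  rw [diag, diag, entry, entry, h]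
  rfl

/-- The weights decay exponentially, and since `b i` lies in one sector the diagonal entries inherit
the bound. The bound on weights is returned too: it makes partial traces converge in norm. -/
theorem IsEigenbasis.isDensity (hb : IsEigenbasis G J U μ b ε) (hU : 0 < U) {β : ℝ} (hβ : 0 < β)
    {ρ : Fock S →L[ℂ] Fock S} {Z : ℝ} (hZ : 1 ≤ Z)
    (hsum : HasSum (fun i => Real.exp (-β * ε i)) Z)
    (hρ : ∀ i, ρ (b i) = ((Real.exp (-β * ε i) / Z : ℝ) : ℂ) • b i) :
    (∃ C : ℝ, 0 ≤ C ∧ ∀ i, Real.exp (-β * ε i) / Z ≤ C * Real.exp (-(3 * deg i))) ∧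
    IsDensity ρ b fun i => Real.exp (-β * ε i) / Z := by
  have hZ0 : 0 < Z := by linarith
  obtain ⟨C, hC0, hC⟩ := hb.exists_exp_le hU hβ
  have hr : ∀ i, Real.exp (-β * ε i) / Z ≤ C * Real.exp (-(3 * deg i)) := fun i =>
    (div_le_self (Real.exp_pos _).le hZ).trans (hC i)
  refine ⟨⟨C, hC0.le, hr⟩, hb.support, hρ, fun i => by positivity, ?_, C, fun k => ?_⟩
  · simpa [hZ0.ne'] using hsum.div_const Z
  · have h1 := hasSum_entry_self b hρ k
    have h2 := (hasSum_norm_sq_apply b k).mul_left (C * Real.exp (-(3 * deg k)))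
    rw [mul_one] at h2
    refine hasSum_le (fun i => ?_) h1 h2
    by_cases h : deg k = deg i
    · rw [h]
      exact mul_le_mul_of_nonneg_right (hr i) (sq_nonneg _)
    · simp [hb.support i k h]

end Gibbs

/-! ### Reduced density matrices -/

section DiagonalOperators

variable {κ ι : Type} (b : HilbertBasis ι ℂ (L2 κ)) {T : L2 κ →L[ℂ] L2 κ} {r : ι → ℝ}

theorem inner_basis_apply (hT : ∀ i, T (b i) = (r i : ℂ) • b i) (i : ι) (ψ : L2 κ) :
    ⟪b i, T ψ⟫_ℂ = r i * ⟪b i, ψ⟫_ℂ := by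
  have h := isSelfAdjoint_of_eigenbasis b hT
  rw [← ContinuousLinearMap.adjoint_inner_left, ContinuousLinearMap.isSelfAdjoint_iff'.1 h, hT,
    inner_smul_left, Complex.conj_ofReal]

/-- Parseval: only the weights of basis vectors occurring in `ψ` enter the norm. -/
theorem norm_apply_le_of_weights (hT : ∀ i, T (b i) = (r i : ℂ) • b i) {K : ℝ} (hK : 0 ≤ K)
    {ψ : L2 κ} (h : ∀ i, ⟪b i, ψ⟫_ℂ ≠ 0 → |r i| ≤ K) : ‖T ψ‖ ≤ K * ‖ψ‖ := by
  refine le_of_sq_le_sq ?_ (mul_nonneg hK (norm_nonneg _))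
  rw [mul_pow]
  refine hasSum_le (fun i => ?_) (hasSum_norm_sq_inner b (T ψ))
    ((hasSum_norm_sq_inner b ψ).mul_left (K ^ 2))
  rw [inner_basis_apply b hT, norm_mul, mul_pow, Complex.norm_real, Real.norm_eq_abs]
  by_cases hi : ⟪b i, ψ⟫_ℂ = 0
  · simp [hi]
  · have := h i hi
    gcongr

theorem re_inner_apply_nonneg (hT : ∀ i, T (b i) = (r i : ℂ) • b i) (hr : ∀ i, 0 ≤ r i)
    (ψ : L2 κ) : 0 ≤ (⟪ψ, T ψ⟫_ℂ).re := by
  refine (Complex.hasSum_re (b.hasSum_inner_mul_inner ψ (T ψ))).nonneg fun i => ?_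
  rw [inner_basis_apply b hT, mul_left_comm, ← inner_conj_symm ψ (b i), mul_comm (conj _),
    Complex.mul_conj, ← Complex.ofReal_mul, Complex.ofReal_re]
  exact mul_nonneg (hr i) (Complex.normSq_nonneg _)

end DiagonalOperators

/-! ### Configurations on X and off X; slices and their adjoints -/

section Glue

variable {S : Type} (X : Set S)

theorem glue_of_mem (m : {x // x ∉ X} → ℕ) (k : X → ℕ) {x : S} (h : x ∈ X) :
    glue X m k x = k ⟨x, h⟩ := by simp [glue, h]

theorem glue_of_notMem (m : {x // x ∉ X} → ℕ) (k : X → ℕ) {x : S} (h : x ∉ X) :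
    glue X m k x = m ⟨x, h⟩ := by simp [glue, h]

/-- Configurations are pairs of a configuration on `X` and one off `X`. -/
def glueEquiv : (X → ℕ) × ({x // x ∉ X} → ℕ) ≃ (S → ℕ) where
  toFun p := glue X p.2 p.1
  invFun k := (fun x => k x, fun x => k x)
  left_inv p := Prod.ext (funext fun x => glue_of_mem X _ _ x.2)
    (funext fun x => glue_of_notMem X _ _ x.2)
  right_inv k := funext fun x => by
    by_cases h : x ∈ X
    · exact glue_of_mem X _ _ h
    · exact glue_of_notMem X _ _ h

theorem glueEquiv_apply (p : (X → ℕ) × ({x // x ∉ X} → ℕ)) : glueEquiv X p = glue X p.2 p.1 := rfl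

theorem glue_inj {m m' : {x // x ∉ X} → ℕ} {k k' : X → ℕ} :
    glue X m k = glue X m' k' ↔ k = k' ∧ m = m' := by
  rw [← glueEquiv_apply X (k, m), ← glueEquiv_apply X (k', m'), (glueEquiv X).injective.eq_iff,
    Prod.mk.injEq]

theorem deg_glue [Fintype S] [Fintype X] [Fintype {x // x ∉ X}] (m : {x // x ∉ X} → ℕ)
    (k : X → ℕ) : deg (glue X m k) = deg k + deg m := by
  classical
  rw [deg, deg, deg, ← Fintype.sum_subtype_add_sum_subtype (fun x => x ∈ X) (glue X m k)]
  congr 1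
  · exact Finset.sum_congr (Finset.ext fun x => by simp) fun x _ => glue_of_mem X m k x.2
  · exact Finset.sum_congr (Finset.ext fun x => by simp) fun x _ => glue_of_notMem X m k x.2

theorem slice_apply (m : {x // x ∉ X} → ℕ) (ψ : Fock S) (k : X → ℕ) :
    slice X m ψ k = ψ (glue X m k) := rfl

theorem slice_adjoint_ket (m : {x // x ∉ X} → ℕ) (k : X → ℕ) :
    (slice X m).adjoint (ket k) = ket (glue X m k) := by
  refine ext_inner_right ℂ fun ψ => ?_
  rw [ContinuousLinearMap.adjoint_inner_left, inner_ket_left, inner_ket_left, slice_apply]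

open scoped Classical in
theorem slice_adjoint_apply (m m' : {x // x ∉ X} → ℕ) (φ : Fock X) (k : X → ℕ) :
    (slice X m).adjoint φ (glue X m' k) = if m = m' then φ k else 0 := by
  rw [← inner_ket_left, ContinuousLinearMap.adjoint_inner_right]
  have h : slice X m (ket (glue X m' k)) = if m = m' then ket k else 0 := by
    ext l
    rw [slice_apply, ket_apply]
    by_cases hm : m = m'
    · rw [if_pos hm, ket_apply]
      simp [glue_inj, hm]
    · rw [if_neg hm]
      simp [glue_inj, hm]
  rw [h]
  split_ifs
  · rw [inner_ket_left]
  · rw [inner_zero_left]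

theorem norm_slice_le (m : {x // x ∉ X} → ℕ) : ‖slice X m‖ ≤ 1 :=
  LinearMap.mkContinuous_norm_le _ zero_le_one _

end Glue

/-! ### Convergence of partial traces; marginals are density matrices -/

section Reduction

variable {S : Type} [Fintype S] (X : Set S) [Fintype X] [Fintype {x // x ∉ X}]
  {ρ : Fock S →L[ℂ] Fock S} {b : HilbertBasis (S → ℕ) ℂ (Fock S)} {r : (S → ℕ) → ℝ} {C : ℝ}

/-- The adjoint slice places `deg m` particles off `X`, so its image meets only sectors with at
least that many particles, where the weights are small. -/
theorem IsDensity.norm_slice_comp_le (h : IsDensity ρ b r) (hC0 : 0 ≤ C)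
    (hC : ∀ i, r i ≤ C * Real.exp (-(3 * deg i))) (m : {x // x ∉ X} → ℕ) :
    ‖slice X m ∘L ρ ∘L (slice X m).adjoint‖ ≤ C * Real.exp (-(3 * deg m)) := by
  have hK : 0 ≤ C * Real.exp (-(3 * deg m)) := by positivity
  refine ContinuousLinearMap.opNorm_le_bound _ hK fun φ => ?_
  have h1 : ‖(slice X m).adjoint φ‖ ≤ ‖φ‖ := by
    refine ((slice X m).adjoint.le_opNorm φ).trans ?_
    rw [LinearIsometryEquiv.norm_map]
    exact mul_le_of_le_one_left (norm_nonneg _) (norm_slice_le X m)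
  have h2 : ‖ρ ((slice X m).adjoint φ)‖ ≤
      C * Real.exp (-(3 * deg m)) * ‖(slice X m).adjoint φ‖ := by
    refine norm_apply_le_of_weights b h.apply hK fun i hi => ?_
    rw [abs_of_nonneg (h.nonneg i)]
    refine (hC i).trans ?_
    have hdeg : deg m ≤ deg i := by
      by_contra hlt
      refine hi ?_
      rw [ContinuousLinearMap.adjoint_inner_right]
      have : slice X m (b i) = 0 := by
        ext k
        rw [slice_apply, h.support i]
        · rfl
        · rw [deg_glue]
          omega
      rw [this, inner_zero_left]
    have : (deg m : ℝ) ≤ deg i := by exact_mod_cast hdeg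
    gcongr
  calc ‖slice X m (ρ ((slice X m).adjoint φ))‖ ≤ 1 * ‖ρ ((slice X m).adjoint φ)‖ :=
        (slice X m).le_of_opNorm_le (norm_slice_le X m) _
    _ ≤ C * Real.exp (-(3 * deg m)) * ‖φ‖ := by
        rw [one_mul]
        exact h2.trans (mul_le_mul_of_nonneg_left h1 hK)

theorem summable_exp_neg_three_deg (S : Type) [Fintype S] :
    Summable fun k : S → ℕ => Real.exp (-(3 * (deg k : ℝ))) := by
  refine Summable.of_nonneg_of_le (fun k => (Real.exp_pos _).le) (fun k => ?_)
    (summable_exp_neg_deg (S := S))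
  rw [Real.exp_le_exp]
  have : (0 : ℝ) ≤ deg k := Nat.cast_nonneg _
  linarith

/-- Ensures that the `tsum` defining `reduced` is a true limit and not the default value 0. -/
theorem IsDensity.hasSum_reduced (h : IsDensity ρ b r) (hC0 : 0 ≤ C)
    (hC : ∀ i, r i ≤ C * Real.exp (-(3 * deg i))) :
    HasSum (fun m => slice X m ∘L ρ ∘L (slice X m).adjoint) (reduced X ρ) :=
  (Summable.of_norm_bounded ((summable_exp_neg_three_deg _).mul_left C)
    (h.norm_slice_comp_le X hC0 hC)).hasSum

theorem IsDensity.hasSum_entry_reduced (h : IsDensity ρ b r) (hC0 : 0 ≤ C)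
    (hC : ∀ i, r i ≤ C * Real.exp (-(3 * deg i))) (k l : X → ℕ) :
    HasSum (fun m => entry ρ (glue X m k) (glue X m l)) (entry (reduced X ρ) k l) := by
  have h1 := (h.hasSum_reduced X hC0 hC).mapL
    (evalL k ∘L ContinuousLinearMap.apply ℂ (Fock X) (ket l))
  simp only [ContinuousLinearMap.comp_apply, ContinuousLinearMap.apply_apply, evalL_apply,
    slice_adjoint_ket] at h1
  exact h1

/-- The reduced density matrix is again a density matrix with exponentially decaying diagonal. -/
theorem IsDensity.exists_isDensity_reduced (h : IsDensity ρ b r) (hC0 : 0 ≤ C)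
    (hC : ∀ i, r i ≤ C * Real.exp (-(3 * deg i))) :
    ∃ u q, IsDensity (reduced X ρ) u q := by
  classical
  have hent := h.hasSum_entry_reduced X hC0 hC
  have hherm : ∀ k l, entry (reduced X ρ) l k = conj (entry (reduced X ρ) k l) := by
    intro k l
    refine (hent l k).unique ?_
    convert! (hent k l).map (starRingEnd ℂ) Complex.continuous_conj using 1
    funext m
    exact (conj_entry b h.apply _ _).symm
  -- The partial trace keeps the same `m` on both sides, so conservation of the total number becomes
  -- conservation on `X`.
  have hzero : ∀ k l, deg k ≠ deg l → entry (reduced X ρ) k l = 0 := by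
    intro k l hkl
    refine (hent k l).unique ?_
    convert! (hasSum_zero : HasSum (fun _ : {x // x ∉ X} → ℕ => (0 : ℂ)) 0) using 1
    funext m
    refine h.entry_eq_zero ?_
    rw [deg_glue, deg_glue]
    omega
  obtain ⟨u, q, hu, hq⟩ := exists_graded_eigenbasis (deg : (X → ℕ) → ℕ) (sector X) mem_sector
    (entry (reduced X ρ)) hherm
  have happly : ∀ i, reduced X ρ (u i) = (q i : ℂ) • u i := by
    intro i
    ext k
    rw [apply_eq_sum_of_support (s := sector X (deg i))
      (fun k hk => hu i k fun h' => hk ((mem_sector _ _).2 h'))]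
    by_cases hk : deg k = deg i
    · exact hq i k hk
    · rw [lp.coeFn_smul, Pi.smul_apply, hu i k hk, smul_zero]
      refine Finset.sum_eq_zero fun l hl => ?_
      rw [hzero k l, zero_mul]
      rwa [(mem_sector _ _).1 hl]
  have hnonneg : ∀ i, 0 ≤ q i := by
    intro i
    have h1 : ⟪u i, reduced X ρ (u i)⟫_ℂ = q i := by
      rw [happly, inner_smul_right, inner_self_eq_norm_sq_to_K, u.orthonormal.1 i]
      simp
    have h2 := Complex.hasSum_re ((h.hasSum_reduced X hC0 hC).mapL
      (innerSL ℂ (u i) ∘L ContinuousLinearMap.apply ℂ (Fock X) (u i)))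
    simp only [ContinuousLinearMap.comp_apply, ContinuousLinearMap.apply_apply,
      innerSL_apply_apply, h1, Complex.ofReal_re] at h2
    refine h2.nonneg fun m => ?_
    rw [← ContinuousLinearMap.adjoint_inner_left]
    exact re_inner_apply_nonneg b h.apply h.nonneg _
  have hdiag : ∀ k, HasSum (fun m => diag ρ (glue X m k)) (diag (reduced X ρ) k) := fun k =>
    Complex.hasSum_re (hent k k)
  refine ⟨u, q, hu, happly, hnonneg, ?_, ?_⟩
  · refine (hasSum_entry_self_trace u hnonneg happly zero_le_one).1 ?_
    exact ((glueEquiv X).hasSum_iff.2 h.hasSum_diag).prod_fiberwise hdiag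
  · obtain ⟨C', hC'⟩ := h.decay
    refine ⟨C' * ∑' m : {x // x ∉ X} → ℕ, Real.exp (-(3 * (deg m : ℝ))), fun k => ?_⟩
    have hs := ((summable_exp_neg_three_deg {x // x ∉ X}).hasSum.mul_left C').mul_right
      (Real.exp (-(3 * deg k)))
    refine hasSum_le (fun m => ?_) (hdiag k) hs
    refine (hC' _).trans (le_of_eq ?_)
    rw [mul_assoc, ← Real.exp_add, deg_glue]
    congr 2
    push_cast
    ring

end Reduction

/-! ### Product bases and product states -/

section ProductBasis

theorem hasSum_mul_prod {𝕜 : Type*} [RCLike 𝕜] {α γ : Type*} {f : α → 𝕜} {g : γ → 𝕜} {s t : 𝕜}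
    (hf : HasSum f s) (hg : HasSum g t) : HasSum (fun i : α × γ => f i.1 * g i.2) (s * t) :=
  hf.mul hg (summable_mul_of_summable_norm hf.summable.norm hg.summable.norm)

theorem eq_zero_of_forall_inner_eq_zero {κ ι : Type} (b : HilbertBasis ι ℂ (L2 κ)) {ψ : L2 κ}
    (h : ∀ i, ⟪b i, ψ⟫_ℂ = 0) : ψ = 0 := by
  refine b.repr.injective (lp.ext (funext fun i => ?_))
  rw [b.repr_apply_apply, h, map_zero]
  rfl

variable {S : Type} (A : Set S) [Fintype {x // x ∉ A}]
  (u : HilbertBasis (A → ℕ) ℂ (Fock A))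
  (v : HilbertBasis ({x // x ∉ A} → ℕ) ℂ (Fock {x // x ∉ A}))

open scoped Classical in
/-- The product vector `u_a ⊗ v_c`. -/
def prodVec (i : (A → ℕ) × ({x // x ∉ A} → ℕ)) : Fock S :=
  ∑ m ∈ sector {x // x ∉ A} (deg i.2), v i.2 m • (slice A m).adjoint (u i.1)

variable {v}

theorem prodVec_apply (hv : ∀ i k, deg k ≠ deg i → v i k = 0)
    (i : (A → ℕ) × ({x // x ∉ A} → ℕ)) (m : {x // x ∉ A} → ℕ) (k : A → ℕ) :
    prodVec A u v i (glue A m k) = u i.1 k * v i.2 m := by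
  classical
  rw [prodVec, lp.coeFn_sum, Finset.sum_apply]
  simp only [lp.coeFn_smul, Pi.smul_apply, slice_adjoint_apply, smul_eq_mul, mul_ite, mul_zero]
  rw [Finset.sum_ite_eq']
  split_ifs with h
  · rw [mul_comm]
  · rw [hv i.2 m, mul_zero]
    exact fun h' => h ((mem_sector _ _).2 h')

theorem slice_prodVec (hv : ∀ i k, deg k ≠ deg i → v i k = 0)
    (i : (A → ℕ) × ({x // x ∉ A} → ℕ)) (m : {x // x ∉ A} → ℕ) :
    slice A m (prodVec A u v i) = v i.2 m • u i.1 := by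
  ext k
  rw [slice_apply, prodVec_apply A u hv, lp.coeFn_smul, Pi.smul_apply, smul_eq_mul, mul_comm]

open scoped Classical in
theorem inner_prodVec (i : (A → ℕ) × ({x // x ∉ A} → ℕ)) (ψ : Fock S) :
    ⟪prodVec A u v i, ψ⟫_ℂ =
      ∑ m ∈ sector {x // x ∉ A} (deg i.2), conj (v i.2 m) * ⟪u i.1, slice A m ψ⟫_ℂ := by
  simp only [prodVec, sum_inner, inner_smul_left, ContinuousLinearMap.adjoint_inner_left]

theorem orthonormal_prodVec (hv : ∀ i k, deg k ≠ deg i → v i k = 0) :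
    Orthonormal ℂ (prodVec A u v) := by
  classical
  rw [orthonormal_iff_ite]
  intro i j
  have hs : ∀ k ∉ sector {x // x ∉ A} (deg i.2), v i.2 k = 0 := fun k hk =>
    hv _ _ fun h => hk ((mem_sector _ _).2 h)
  rw [inner_prodVec]
  simp only [slice_prodVec A u hv, inner_smul_right, ← mul_assoc]
  rw [← Finset.sum_mul, ← inner_eq_sum_of_support hs, orthonormal_iff_ite.1 v.orthonormal,
    orthonormal_iff_ite.1 u.orthonormal]
  by_cases h1 : i.1 = j.1 <;> by_cases h2 : i.2 = j.2 <;> simp [Prod.ext_iff, h1, h2]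

/-- Two stages: for fixed `c`, testing against all `a` kills a vector of `Fock A`; then, for each
fixed configuration on `A`, testing against all `c` kills the remaining vector. -/
theorem span_prodVec_orthogonal (hv : ∀ i k, deg k ≠ deg i → v i k = 0) :
    (Submodule.span ℂ (Set.range (prodVec A u v)))ᗮ = ⊥ := by
  classical
  rw [Submodule.eq_bot_iff]
  intro ψ hψ
  have h0 : ∀ i, ⟪prodVec A u v i, ψ⟫_ℂ = 0 := fun i =>
    (Submodule.mem_orthogonal _ _).1 hψ _ (Submodule.subset_span ⟨i, rfl⟩)
  have h1 : ∀ c, ∑ m ∈ sector {x // x ∉ A} (deg c), conj (v c m) • slice A m ψ = 0 := by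
    intro c
    refine eq_zero_of_forall_inner_eq_zero u fun a => ?_
    rw [inner_sum, ← h0 (a, c), inner_prodVec]
    simp only [inner_smul_right]
  have hinj : ∀ k : A → ℕ, Function.Injective fun m => glue A m k := fun k m m' h =>
    ((glue_inj A).1 h).2
  have h2 : ∀ k : A → ℕ, compL (fun m => glue A m k) (hinj k) ψ = 0 := by
    intro k
    refine eq_zero_of_forall_inner_eq_zero v fun c => ?_
    rw [inner_eq_sum_of_support (s := sector {x // x ∉ A} (deg c))
      fun m hm => hv _ _ fun h => hm ((mem_sector _ _).2 h)]
    have h3 := congrArg (fun φ : Fock A => φ k) (h1 c)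
    simp only [lp.coeFn_sum, Finset.sum_apply, lp.coeFn_smul, Pi.smul_apply, smul_eq_mul,
      slice_apply] at h3
    exact h3
  ext k
  obtain ⟨⟨a, m⟩, rfl⟩ := (glueEquiv A).surjective k
  exact congrArg (fun φ : Fock {x // x ∉ A} => φ m) (h2 a)

/-- The product basis. -/
def prodBasis (hv : ∀ i k, deg k ≠ deg i → v i k = 0) :
    HilbertBasis ((A → ℕ) × ({x // x ∉ A} → ℕ)) ℂ (Fock S) :=
  HilbertBasis.mkOfOrthogonalEqBot (orthonormal_prodVec A u hv) (span_prodVec_orthogonal A u hv)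

theorem prodBasis_apply (hv : ∀ i k, deg k ≠ deg i → v i k = 0)
    (i : (A → ℕ) × ({x // x ∉ A} → ℕ)) (m : {x // x ∉ A} → ℕ) (k : A → ℕ) :
    prodBasis A u hv i (glue A m k) = u i.1 k * v i.2 m := by
  rw [prodBasis, HilbertBasis.coe_mkOfOrthogonalEqBot, prodVec_apply A u hv]

end ProductBasis

/-! ### Spectral data and entropy of the product state -/

section ProductState

variable {S : Type} {A : Set S} {RA : Fock A →L[ℂ] Fock A}
  {RB : Fock {x // x ∉ A} →L[ℂ] Fock {x // x ∉ A}}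

/-- The matrix of `R_A ⊗ R_B`. -/
def prodMat (RA : Fock A →L[ℂ] Fock A) (RB : Fock {x // x ∉ A} →L[ℂ] Fock {x // x ∉ A})
    (k l : S → ℕ) : ℂ :=
  entry RA ((glueEquiv A).symm k).1 ((glueEquiv A).symm l).1 *
    entry RB ((glueEquiv A).symm k).2 ((glueEquiv A).symm l).2

/-- The diagonal of `R_A ⊗ R_B`. -/
def prodDiag (RA : Fock A →L[ℂ] Fock A) (RB : Fock {x // x ∉ A} →L[ℂ] Fock {x // x ∉ A})
    (k : S → ℕ) : ℝ :=
  diag RA ((glueEquiv A).symm k).1 * diag RB ((glueEquiv A).symm k).2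

theorem glueEquiv_symm_glue (m : {x // x ∉ A} → ℕ) (k : A → ℕ) :
    (glueEquiv A).symm (glue A m k) = (k, m) := (glueEquiv A).symm_apply_apply (k, m)

theorem prodMat_glue (m m' : {x // x ∉ A} → ℕ) (k k' : A → ℕ) :
    prodMat RA RB (glue A m k) (glue A m' k') = entry RA k k' * entry RB m m' := by
  rw [prodMat, glueEquiv_symm_glue, glueEquiv_symm_glue]

theorem prodDiag_glue (m : {x // x ∉ A} → ℕ) (k : A → ℕ) :
    prodDiag RA RB (glue A m k) = diag RA k * diag RB m := by
  rw [prodDiag, glueEquiv_symm_glue]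

variable [Fintype A] [Fintype {x // x ∉ A}]
  {u : HilbertBasis (A → ℕ) ℂ (Fock A)} {p : (A → ℕ) → ℝ}
  {v : HilbertBasis ({x // x ∉ A} → ℕ) ℂ (Fock {x // x ∉ A})} {q : ({x // x ∉ A} → ℕ) → ℝ}

theorem hasSum_prodMat (hA : IsDensity RA u p) (hB : IsDensity RB v q) (k l : S → ℕ) :
    HasSum (fun i : (A → ℕ) × ({x // x ∉ A} → ℕ) => ((p i.1 * q i.2 : ℝ) : ℂ) *
      (prodBasis A u hB.support i k * conj (prodBasis A u hB.support i l)))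
      (prodMat RA RB k l) := by
  obtain ⟨⟨a, m⟩, rfl⟩ := (glueEquiv A).surjective k
  obtain ⟨⟨a', m'⟩, rfl⟩ := (glueEquiv A).surjective l
  have h3 := hasSum_mul_prod (hasSum_entry u hA.apply a a') (hasSum_entry v hB.apply m m')
  rw [glueEquiv_apply, glueEquiv_apply, prodMat_glue]
  convert! h3 using 1
  funext i
  rw [prodBasis_apply, prodBasis_apply, map_mul, Complex.ofReal_mul]
  ring

/-- Expands ⟨ψ, (R_A ⊗ R_B)ψ⟩ in the product eigenbasis. It shows this form to be nonnegative and
identifies the inner sum in Klein's inequality. -/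
theorem hasSum_weight_mul_norm_sq [Fintype S] [DecidableEq S] (hA : IsDensity RA u p) (hB : IsDensity RB v q)
    {N : ℕ} {ψ : Fock S} (hψ : ∀ k ∉ sector S N, ψ k = 0) :
    HasSum (fun i : (A → ℕ) × ({x // x ∉ A} → ℕ) =>
      p i.1 * q i.2 * ‖⟪prodBasis A u hB.support i, ψ⟫_ℂ‖ ^ 2)
      (sectorForm (prodMat RA RB) N ψ).re := by
  have h1 := hasSum_sum (s := sector S N) fun k _ => hasSum_sum (s := sector S N) fun l _ =>
    (hasSum_prodMat hA hB l k).mul_right (ψ k * conj (ψ l))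
  convert! Complex.hasSum_re h1 using 1
  funext i
  set w := prodBasis A u hB.support i
  have h2 : ⟪ψ, w⟫_ℂ = ∑ l ∈ sector S N, conj (ψ l) * w l := inner_eq_sum_of_support hψ w
  have h3 : ((‖⟪w, ψ⟫_ℂ‖ ^ 2 : ℝ) : ℂ) = conj ⟪ψ, w⟫_ℂ * ⟪ψ, w⟫_ℂ := by
    rw [mul_comm, Complex.mul_conj, Complex.normSq_eq_norm_sq, norm_inner_symm]
  have h4 : ((p i.1 * q i.2 * ‖⟪w, ψ⟫_ℂ‖ ^ 2 : ℝ) : ℂ) = ∑ k ∈ sector S N, ∑ l ∈ sector S N,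
      ((p i.1 * q i.2 : ℝ) : ℂ) * (w l * conj (w k)) * (ψ k * conj (ψ l)) := by
    rw [Complex.ofReal_mul, h3, h2, map_sum, Finset.sum_mul_sum, Finset.mul_sum]
    refine Finset.sum_congr rfl fun k _ => ?_
    rw [Finset.mul_sum]
    refine Finset.sum_congr rfl fun l _ => ?_
    rw [map_mul, Complex.conj_conj]
    ring
  rw [← h4, Complex.ofReal_re]

/-- Additivity on product states: -pq ln(pq) = q(-p ln p) + p(-q ln q), with both weights summing to
1. -/
theorem entropy_add_entropy (hA : IsDensity RA u p) (hB : IsDensity RB v q) :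
    entropy RA + entropy RB = ∑' i : (A → ℕ) × ({x // x ∉ A} → ℕ),
      ENNReal.ofReal (Real.negMulLog (p i.1 * q i.2)) := by
  have hterm : ∀ a c, ENNReal.ofReal (Real.negMulLog (p a * q c)) =
      ENNReal.ofReal (Real.negMulLog (p a)) * ENNReal.ofReal (q c) +
        ENNReal.ofReal (p a) * ENNReal.ofReal (Real.negMulLog (q c)) := by
    intro a c
    have h1 := Real.negMulLog_nonneg (hA.nonneg a) (hA.weight_le_one a)
    have h2 := Real.negMulLog_nonneg (hB.nonneg c) (hB.weight_le_one c)
    rw [Real.negMulLog_mul, mul_comm (q c), ENNReal.ofReal_add (mul_nonneg h1 (hB.nonneg c))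
      (mul_nonneg (hA.nonneg a) h2), ENNReal.ofReal_mul h1, ENNReal.ofReal_mul (hA.nonneg a)]
  have hone : ∀ {α : Type} {g : α → ℝ}, (∀ i, 0 ≤ g i) → HasSum g 1 →
      ∑' i, ENNReal.ofReal (g i) = 1 := by
    intro α g hg h
    rw [← ENNReal.ofReal_tsum_of_nonneg hg h.summable, h.tsum_eq, ENNReal.ofReal_one]
  rw [ENNReal.tsum_prod', hA.entropy_eq, hB.entropy_eq]
  simp only [hterm, ENNReal.tsum_add, ENNReal.tsum_mul_left, ENNReal.tsum_mul_right,
    hone hB.nonneg hB.trace, hone hA.nonneg hA.trace, mul_one, one_mul]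

theorem hasSum_weight_prod (hA : IsDensity RA u p) (hB : IsDensity RB v q) :
    HasSum (fun i : (A → ℕ) × ({x // x ∉ A} → ℕ) => p i.1 * q i.2) 1 := by
  simpa using hA.trace.mul hB.trace
    (hA.trace.summable.mul_of_nonneg hB.trace.summable hA.nonneg hB.nonneg)

theorem norm_prodMat_sq_le (hA : IsDensity RA u p) (hB : IsDensity RB v q) (k l : S → ℕ) :
    ‖prodMat RA RB k l‖ ^ 2 ≤ prodDiag RA RB k * prodDiag RA RB l := by
  rw [prodMat, norm_mul, mul_pow, prodDiag, prodDiag, mul_mul_mul_comm]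
  exact mul_le_mul (hA.norm_entry_sq_le _ _) (hB.norm_entry_sq_le _ _) (sq_nonneg _)
    (mul_nonneg (hA.diag_nonneg _) (hA.diag_nonneg _))

theorem prodDiag_nonneg (hA : IsDensity RA u p) (hB : IsDensity RB v q) (k : S → ℕ) :
    0 ≤ prodDiag RA RB k := mul_nonneg (hA.diag_nonneg _) (hB.diag_nonneg _)

theorem prodMat_self (hA : IsDensity RA u p) (hB : IsDensity RB v q) (k : S → ℕ) :
    prodMat RA RB k k = prodDiag RA RB k := by
  rw [prodMat, prodDiag, hA.entry_self, hB.entry_self, Complex.ofReal_mul]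

end ProductState

/-! ### Energy of the product of the marginals -/

section Marginals

/-- Fubini for a local observable: if the factor `F` ignores the second variable, summing that
variable out gives ∑ F R, and multiplying by ∑ q = 1 puts an independent second factor back. On-site
moments and interior hopping are both instances. -/
theorem hasSum_marginal {𝕜 : Type*} [RCLike 𝕜] {α γ κ : Type} (e : α × γ ≃ κ) {g g' : κ → 𝕜}
    {F R : α → 𝕜} {f : α → γ → 𝕜} {q : γ → 𝕜} (hR : ∀ a, HasSum (f a) (R a)) (hq : HasSum q 1)
    (hg : ∀ a c, g (e (a, c)) = F a * f a c) (hg' : ∀ a c, g' (e (a, c)) = F a * (R a * q c))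
    (hs : Summable g) : HasSum g' (∑' k, g k) := by
  have h1 : HasSum (fun a => F a * R a) (∑' k, g k) := by
    refine (e.hasSum_iff.2 hs.hasSum).prod_fiberwise fun a => ?_
    simp only [Function.comp_apply, hg]
    exact (hR a).mul_left (F a)
  have h2 := hasSum_mul_prod h1 hq
  rw [mul_one] at h2
  rw [← e.hasSum_iff]
  convert! h2 using 1
  funext i
  simp only [Function.comp_apply]
  rw [← Prod.mk.eta (p := i), hg', mul_assoc]

variable {S : Type} {A : Set S}

section Hopping

variable [DecidableEq S]

theorem hop_glue_of_mem {x y : S} (hx : x ∈ A) (hy : y ∈ A) (m : {x // x ∉ A} → ℕ) (k : A → ℕ) :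
    hop x y (glue A m k) = glue A m (hop ⟨x, hx⟩ ⟨y, hy⟩ k) := by
  funext z
  by_cases hz : z ∈ A
  · rw [glue_of_mem A _ _ hz]
    simp only [hop, Pi.add_apply, Pi.sub_apply, glue_of_mem A _ _ hz, Pi.single_apply,
      Subtype.mk.injEq]
  · rw [glue_of_notMem A _ _ hz]
    have h1 : z ≠ x := fun h => hz (h ▸ hx)
    have h2 : z ≠ y := fun h => hz (h ▸ hy)
    simp [hop, glue_of_notMem A _ _ hz, h1, h2]

theorem hop_glue_of_notMem {x y : S} (hx : x ∉ A) (hy : y ∉ A) (m : {x // x ∉ A} → ℕ)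
    (k : A → ℕ) : hop x y (glue A m k) = glue A (hop ⟨x, hx⟩ ⟨y, hy⟩ m) k := by
  funext z
  by_cases hz : z ∈ A
  · rw [glue_of_mem A _ _ hz]
    have h1 : z ≠ x := fun h => hx (h ▸ hz)
    have h2 : z ≠ y := fun h => hy (h ▸ hz)
    simp [hop, glue_of_mem A _ _ hz, h1, h2]
  · rw [glue_of_notMem A _ _ hz]
    simp only [hop, Pi.add_apply, Pi.sub_apply, glue_of_notMem A _ _ hz, Pi.single_apply,
      Subtype.mk.injEq]

theorem restrict_add_single_of_notMem {x : S} (hx : x ∉ A) (n : S → ℕ) :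
    ((glueEquiv A).symm (n + Pi.single x 1)).1 = ((glueEquiv A).symm n).1 := by
  funext z
  have h : (z : S) ≠ x := fun h => hx (h ▸ z.2)
  simp [glueEquiv, h]

theorem deg_restrict_add_single_of_mem [Fintype A] {x : S} (hx : x ∈ A) (n : S → ℕ) :
    deg ((glueEquiv A).symm (n + Pi.single x 1)).1 = deg ((glueEquiv A).symm n).1 + 1 := by
  classical
  have h : ((glueEquiv A).symm (n + Pi.single x 1)).1 =
      ((glueEquiv A).symm n).1 + Pi.single ⟨x, hx⟩ 1 := by
    funext z
    simp [glueEquiv, Pi.single_apply, Subtype.ext_iff]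
  rw [h, deg_add_single]

/-- Hopping between `A` and its complement has zero expectation in a product state. -/
theorem hopExp_prodMat_of_not_iff [Fintype A] {RA : Fock A →L[ℂ] Fock A}
    {RB : Fock {x // x ∉ A} →L[ℂ] Fock {x // x ∉ A}} {u : HilbertBasis (A → ℕ) ℂ (Fock A)}
    {p : (A → ℕ) → ℝ} (hA : IsDensity RA u p) {x y : S} (h : ¬(x ∈ A ↔ y ∈ A)) :
    hopExp x y (prodMat RA RB) = 0 := by
  refine (tsum_congr fun k => ?_).trans tsum_zero
  by_cases hk : k x = 0
  · simp [hopCoef_eq_zero hk]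
  · obtain ⟨n, rfl⟩ := exists_eq_add_single hk
    -- A crossing hop changes the particle number of `A` by one, and `RA` has no entries between
    -- different sectors.
    rw [hop_add_single, prodMat, hA.entry_eq_zero, zero_mul, mul_zero]
    by_cases hx : x ∈ A
    · have hy : y ∉ A := fun hy => h ⟨fun _ => hy, fun _ => hx⟩
      rw [restrict_add_single_of_notMem hy, deg_restrict_add_single_of_mem hx]
      omega
    · have hy : y ∈ A := by
        by_contra hy
        exact h ⟨fun h' => absurd h' hx, fun h' => absurd h' hy⟩
      rw [restrict_add_single_of_notMem hx, deg_restrict_add_single_of_mem hy]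
      omega

end Hopping

variable [Fintype A] [Fintype {x // x ∉ A}]
  {ρ : Fock S →L[ℂ] Fock S} {RA : Fock A →L[ℂ] Fock A}
  {RB : Fock {x // x ∉ A} →L[ℂ] Fock {x // x ∉ A}}
  {u : HilbertBasis (A → ℕ) ℂ (Fock A)} {p : (A → ℕ) → ℝ}
  {v : HilbertBasis ({x // x ∉ A} → ℕ) ℂ (Fock {x // x ∉ A})} {q : ({x // x ∉ A} → ℕ) → ℝ}

/-- `R_A` and `R_B` are the marginals of `ρ`. -/
structure IsMarginals (ρ : Fock S →L[ℂ] Fock S) (RA : Fock A →L[ℂ] Fock A)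
    (RB : Fock {x // x ∉ A} →L[ℂ] Fock {x // x ∉ A}) : Prop where
  left : ∀ k l, HasSum (fun m => entry ρ (glue A m k) (glue A m l)) (entry RA k l)
  right : ∀ m n, HasSum (fun k => entry ρ (glue A m k) (glue A n k)) (entry RB m n)

theorem hasSum_site_prodDiag (hA : IsDensity RA u p) (hB : IsDensity RB v q)
    (hM : IsMarginals ρ RA RB) (x : S) (h : ℕ → ℝ) (hs : Summable fun k => h (k x) * diag ρ k) :
    HasSum (fun k => h (k x) * prodDiag RA RB k) (∑' k, h (k x) * diag ρ k) := by
  by_cases hx : x ∈ A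
  · refine hasSum_marginal (glueEquiv A) (F := fun a => h (a ⟨x, hx⟩))
      (fun a => Complex.hasSum_re (hM.left a a)) hB.hasSum_diag (fun a c => ?_) (fun a c => ?_) hs
    · rw [glueEquiv_apply, glue_of_mem A _ _ hx]
      rfl
    · rw [glueEquiv_apply, glue_of_mem A _ _ hx, prodDiag_glue]
      rfl
  · refine hasSum_marginal ((Equiv.prodComm _ _).trans (glueEquiv A))
      (F := fun c => h (c ⟨x, hx⟩))
      (fun c => Complex.hasSum_re (hM.right c c)) hA.hasSum_diag (fun c a => ?_) (fun c a => ?_) hs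
    · rw [Equiv.trans_apply, Equiv.prodComm_apply, glueEquiv_apply, Prod.fst_swap, Prod.snd_swap,
        glue_of_notMem A _ _ hx]
      rfl
    · rw [Equiv.trans_apply, Equiv.prodComm_apply, glueEquiv_apply, Prod.fst_swap, Prod.snd_swap,
        glue_of_notMem A _ _ hx, prodDiag_glue, mul_comm (diag RA a)]
      rfl

theorem hasSum_prodDiag (hA : IsDensity RA u p) (hB : IsDensity RB v q) :
    HasSum (prodDiag RA RB) 1 := by
  rw [← (glueEquiv A).hasSum_iff]
  have h := hA.hasSum_diag.mul hB.hasSum_diag (hA.hasSum_diag.summable.mul_of_nonneg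
    hB.hasSum_diag.summable hA.diag_nonneg hB.diag_nonneg)
  rw [mul_one] at h
  convert! h using 1
  funext i
  exact prodDiag_glue _ _

variable [Fintype S] [DecidableEq S] {b : HilbertBasis (S → ℕ) ℂ (Fock S)} {r : (S → ℕ) → ℝ}

/-- Hopping inside `A` or inside its complement has the same expectation in `ρ` and in the product
of its marginals. -/
theorem hopExp_prodMat_of_iff (hρ : IsDensity ρ b r) (hA : IsDensity RA u p)
    (hB : IsDensity RB v q) (hM : IsMarginals ρ RA RB) {x y : S} (hxy : x ≠ y)
    (h : x ∈ A ↔ y ∈ A) : hopExp x y (prodMat RA RB) = hopExp x y (entry ρ) := by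
  have hs := (summable_hop_and_norm_le hxy hρ.diag_nonneg hρ.norm_entry_sq_le
    (Summable.mean_of_sq hρ.diag_nonneg (hρ.summable_sq x))
    (Summable.mean_of_sq hρ.diag_nonneg (hρ.summable_sq y))).1
  have htrA : HasSum (fun k => entry RA k k) 1 := by
    have := hA.hasSum_diag.mapL Complex.ofRealCLM
    simpa only [Complex.ofRealCLM_apply, Complex.ofReal_one, ← hA.entry_self] using this
  have htrB : HasSum (fun k => entry RB k k) 1 := by
    have := hB.hasSum_diag.mapL Complex.ofRealCLM
    simpa only [Complex.ofRealCLM_apply, Complex.ofReal_one, ← hB.entry_self] using this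
  refine HasSum.tsum_eq ?_
  by_cases hx : x ∈ A
  · have hy := h.1 hx
    refine hasSum_marginal (glueEquiv A) (F := fun a => (hopCoef (⟨x, hx⟩ : A) ⟨y, hy⟩ a : ℂ))
      (fun a => hM.left (hop ⟨x, hx⟩ ⟨y, hy⟩ a) a) htrB (fun a c => ?_) (fun a c => ?_) hs
    · rw [glueEquiv_apply, hop_glue_of_mem hx hy, hopCoef, hopCoef, glue_of_mem A _ _ hx,
        glue_of_mem A _ _ hy]
    · rw [glueEquiv_apply, hop_glue_of_mem hx hy, hopCoef, hopCoef, glue_of_mem A _ _ hx,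
        glue_of_mem A _ _ hy, prodMat_glue]
  · have hy : y ∉ A := fun h' => hx (h.2 h')
    refine hasSum_marginal ((Equiv.prodComm _ _).trans (glueEquiv A))
      (F := fun c => (hopCoef (⟨x, hx⟩ : {x // x ∉ A}) ⟨y, hy⟩ c : ℂ))
      (fun c => hM.right (hop ⟨x, hx⟩ ⟨y, hy⟩ c) c) htrA (fun c a => ?_) (fun c a => ?_) hs
    · rw [Equiv.trans_apply, Equiv.prodComm_apply, glueEquiv_apply, Prod.fst_swap, Prod.snd_swap,
        hop_glue_of_notMem hx hy, hopCoef, hopCoef, glue_of_notMem A _ _ hx,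
        glue_of_notMem A _ _ hy]
    · rw [Equiv.trans_apply, Equiv.prodComm_apply, glueEquiv_apply, Prod.fst_swap, Prod.snd_swap,
        hop_glue_of_notMem hx hy, hopCoef, hopCoef, glue_of_notMem A _ _ hx,
        glue_of_notMem A _ _ hy, prodMat_glue, mul_comm (entry RA a a)]

open scoped Classical in
-- Potential terms and interior hopping agree in both states, and crossing hops vanish in the
-- product, so only the crossing hops of `ρ` survive; each is bounded by the mean occupations of its
-- ends.
theorem totalEnergy_prodMat_sub_le (G : SimpleGraph S) (J U μ : ℝ) (hρ : IsDensity ρ b r)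
    (hA : IsDensity RA u p) (hB : IsDensity RB v q) (hM : IsMarginals ρ RA RB) :
    totalEnergy G J U μ (prodMat RA RB) (prodDiag RA RB)
        - totalEnergy G J U μ (entry ρ) (diag ρ) ≤
      |J| * ∑ x, ∑ y, if G.Adj x y ∧ ¬(x ∈ A ↔ y ∈ A) then
        (mean x (diag ρ) + mean y (diag ρ)) / 2 else 0 := by
  have hmean : ∀ x, mean x (prodDiag RA RB) = mean x (diag ρ) := fun x =>
    (hasSum_site_prodDiag hA hB hM x (fun n => (n : ℝ))
      (Summable.mean_of_sq hρ.diag_nonneg (hρ.summable_sq x))).tsum_eq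
  have hsq := fun x => hasSum_site_prodDiag hA hB hM x (fun n => (n : ℝ) ^ 2) (hρ.summable_sq x)
  have hdiag : ∑' k, diagEnergy U μ k * prodDiag RA RB k = ∑' k, diagEnergy U μ k * diag ρ k := by
    rw [(hasSum_diagEnergy U μ (prodDiag_nonneg hA hB) fun x => (hsq x).summable).tsum_eq,
      (hasSum_diagEnergy U μ hρ.diag_nonneg hρ.summable_sq).tsum_eq]
    simp only [hmean, (hsq _).tsum_eq]
  have hdiff : totalEnergy G J U μ (prodMat RA RB) (prodDiag RA RB)
        - totalEnergy G J U μ (entry ρ) (diag ρ) =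
      J * ∑ x, ∑ y, if G.Adj x y ∧ ¬(x ∈ A ↔ y ∈ A) then (hopExp x y (entry ρ)).re else 0 := by
    have hterm : ∀ x y, (if G.Adj x y ∧ ¬(x ∈ A ↔ y ∈ A) then (hopExp x y (entry ρ)).re else 0) =
        (if G.Adj x y then (hopExp x y (entry ρ)).re else 0) -
          if G.Adj x y then (hopExp x y (prodMat RA RB)).re else 0 := by
      intro x y
      by_cases hxy : G.Adj x y
      · by_cases h : x ∈ A ↔ y ∈ A
        · simp [hxy, h, hopExp_prodMat_of_iff hρ hA hB hM hxy.ne h]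
        · simp [hxy, h, hopExp_prodMat_of_not_iff (RB := RB) hA h]
      · simp [hxy]
    simp only [hterm, Finset.sum_sub_distrib, totalEnergy, hdiag]
    ring
  rw [hdiff]
  refine (le_abs_self _).trans ?_
  rw [abs_mul]
  refine mul_le_mul_of_nonneg_left ?_ (abs_nonneg J)
  refine (Finset.abs_sum_le_sum_abs _ _).trans (Finset.sum_le_sum fun x _ => ?_)
  refine (Finset.abs_sum_le_sum_abs _ _).trans (Finset.sum_le_sum fun y _ => ?_)
  split_ifs with hxy
  · exact (Complex.abs_re_le_norm _).trans (summable_hop_and_norm_le hxy.1.ne hρ.diag_nonneg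
      hρ.norm_entry_sq_le (Summable.mean_of_sq hρ.diag_nonneg (hρ.summable_sq x))
      (Summable.mean_of_sq hρ.diag_nonneg (hρ.summable_sq y))).2
  · simp

end Marginals

/-! ### Mutual information of the Gibbs state -/

section MutualInformation

theorem neg_log_exp_div {β t Z : ℝ} (hZ : 0 < Z) :
    -Real.log (Real.exp (-β * t) / Z) = β * t + Real.log Z := by
  rw [Real.log_div (Real.exp_pos _).ne' hZ.ne', Real.log_exp]
  ring

theorem energy_add_log_nonneg {S : Type} [Fintype S] {β Z : ℝ} {ε : (S → ℕ) → ℝ}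
    {b : HilbertBasis (S → ℕ) ℂ (Fock S)} {ρ : Fock S →L[ℂ] Fock S} (hZ : 0 < Z)
    (hρ : IsDensity ρ b fun i => Real.exp (-β * ε i) / Z) (i : S → ℕ) :
    0 ≤ β * ε i + Real.log Z := by
  rw [← neg_log_exp_div hZ, neg_nonneg]
  exact Real.log_nonpos (hρ.nonneg i) (hρ.weight_le_one i)

variable {S : Type} [Fintype S] [DecidableEq S] {G : SimpleGraph S} {J U μ β Z : ℝ}
  {b : HilbertBasis (S → ℕ) ℂ (Fock S)} {ε : (S → ℕ) → ℝ} {ρ : Fock S →L[ℂ] Fock S}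

/-- `S(ρ) = β tr(ρH) + ln Z`. -/
theorem IsEigenbasis.entropy_gibbs (hb : IsEigenbasis G J U μ b ε) (hZ : 0 < Z)
    (hρ : IsDensity ρ b fun i => Real.exp (-β * ε i) / Z) :
    0 ≤ β * totalEnergy G J U μ (entry ρ) (diag ρ) + Real.log Z ∧
      entropy ρ = ENNReal.ofReal (β * totalEnergy G J U μ (entry ρ) (diag ρ) + Real.log Z) := by
  have hnonneg := energy_add_log_nonneg hZ hρ
  have h := hb.hasSum_trace (β := β) (c := Real.log Z) hnonneg hρ.diag_nonneg hρ.hasSum_diag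
    hρ.entry_self hρ.norm_entry_sq_le hρ.summable_sq
    fun i => by rw [hρ.sectorForm_eq]; exact hρ.nonneg i
  have hterm : ∀ i, Real.negMulLog (Real.exp (-β * ε i) / Z) =
      (β * ε i + Real.log Z) * (sectorForm (entry ρ) (deg i) (b i)).re := by
    intro i
    rw [hρ.sectorForm_eq, Complex.ofReal_re, ← neg_log_exp_div hZ, Real.negMulLog]
    ring
  simp only [← hterm] at h
  have h0 : ∀ i, 0 ≤ Real.negMulLog (Real.exp (-β * ε i) / Z) := fun i =>
    Real.negMulLog_nonneg (hρ.nonneg i) (hρ.weight_le_one i)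
  refine ⟨h.nonneg h0, ?_⟩
  rw [hρ.entropy_eq, ← ENNReal.ofReal_tsum_of_nonneg h0 h.summable, h.tsum_eq]

variable {A : Set S} [Fintype A] [Fintype {x // x ∉ A}]
  {RA : Fock A →L[ℂ] Fock A} {RB : Fock {x // x ∉ A} →L[ℂ] Fock {x // x ∉ A}}
  {u : HilbertBasis (A → ℕ) ℂ (Fock A)} {p : (A → ℕ) → ℝ}
  {v : HilbertBasis ({x // x ∉ A} → ℕ) ℂ (Fock {x // x ∉ A})} {q : ({x // x ∉ A} → ℕ) → ℝ}

/-- The free energy of a product state is at least that of the Gibbs state. -/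
theorem IsEigenbasis.entropy_add_entropy_le (hb : IsEigenbasis G J U μ b ε) (hZ : 0 < Z)
    (hρ : IsDensity ρ b fun i => Real.exp (-β * ε i) / Z) (hA : IsDensity RA u p)
    (hB : IsDensity RB v q) (hM : IsMarginals ρ RA RB) :
    0 ≤ β * totalEnergy G J U μ (prodMat RA RB) (prodDiag RA RB) + Real.log Z ∧
    entropy RA + entropy RB ≤
      ENNReal.ofReal (β * totalEnergy G J U μ (prodMat RA RB) (prodDiag RA RB) + Real.log Z) := by
  have hnonneg := energy_add_log_nonneg hZ hρ
  have hform := fun i => hasSum_weight_mul_norm_sq hA hB (N := deg i) (ψ := b i)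
    fun k hk => hb.notMem hk
  have hterm0 : ∀ i (a : (A → ℕ) × ({x // x ∉ A} → ℕ)),
      0 ≤ p a.1 * q a.2 * ‖⟪prodBasis A u hB.support a, b i⟫_ℂ‖ ^ 2 := fun i a =>
    mul_nonneg (mul_nonneg (hA.nonneg _) (hB.nonneg _)) (sq_nonneg _)
  have hq : ∀ i, 0 ≤ (sectorForm (prodMat RA RB) (deg i) (b i)).re := fun i =>
    (hform i).nonneg (hterm0 i)
  have h := hb.hasSum_trace (β := β) (c := Real.log Z) hnonneg (prodDiag_nonneg hA hB)
    (hasSum_prodDiag hA hB) (prodMat_self hA hB) (norm_prodMat_sq_le hA hB)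
    (fun x => (hasSum_site_prodDiag hA hB hM x (fun n => (n : ℝ) ^ 2) (hρ.summable_sq x)).summable)
    hq
  have h0 := fun i => mul_nonneg (hnonneg i) (hq i)
  refine ⟨h.nonneg h0, ?_⟩
  rw [entropy_add_entropy hA hB, ← h.tsum_eq, ENNReal.ofReal_tsum_of_nonneg h0 h.summable]
  -- Klein's inequality with the product state against the Gibbs state, whose negative logarithm is
  -- βH + ln Z.
  refine (tsum_negMulLog_le (prodBasis A u hB.support) b
    (fun a => mul_nonneg (hA.nonneg _) (hB.nonneg _)) (hasSum_weight_prod hA hB)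
    (fun i => div_pos (Real.exp_pos _) hZ) hρ.trace le_rfl).trans (le_of_eq ?_)
  refine tsum_congr fun i => ?_
  rw [neg_log_exp_div hZ, ENNReal.ofReal_mul (hnonneg i), ← (hform i).tsum_eq,
    ENNReal.ofReal_tsum_of_nonneg (hterm0 i) (hform i).summable]

open scoped Classical in
-- Subtract the Gibbs entropy identity from the variational inequality; ln Z cancels and the energy
-- difference remains. Finiteness of the marginal entropies is needed to pass to real numbers.
theorem IsEigenbasis.mutual_le (hb : IsEigenbasis G J U μ b ε) (hβ : 0 < β) (hZ : 0 < Z)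
    (hρ : IsDensity ρ b fun i => Real.exp (-β * ε i) / Z) (hA : IsDensity RA u p)
    (hB : IsDensity RB v q) (hM : IsMarginals ρ RA RB) :
    (entropy RA).toReal + (entropy RB).toReal - (entropy ρ).toReal ≤
      β * (|J| * ∑ x, ∑ y, if G.Adj x y ∧ ¬(x ∈ A ↔ y ∈ A) then
        (mean x (diag ρ) + mean y (diag ρ)) / 2 else 0) := by
  obtain ⟨h0, h1⟩ := hb.entropy_gibbs hZ hρ
  obtain ⟨h2, h3⟩ := hb.entropy_add_entropy_le hZ hρ hA hB hM
  have hAtop : entropy RA ≠ ⊤ := ne_top_of_le_ne_top ENNReal.ofReal_ne_top hA.entropy_le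
  have hBtop : entropy RB ≠ ⊤ := ne_top_of_le_ne_top ENNReal.ofReal_ne_top hB.entropy_le
  have h4 := ENNReal.toReal_mono ENNReal.ofReal_ne_top h3
  rw [ENNReal.toReal_add hAtop hBtop, ENNReal.toReal_ofReal h2] at h4
  rw [h1, ENNReal.toReal_ofReal h0]
  have h5 := mul_le_mul_of_nonneg_left (totalEnergy_prodMat_sub_le G J U μ hρ hA hB hM) hβ.le
  linarith

end MutualInformation

/-! ### The marginal on the complement -/

section Complement

theorem glue_compl {S : Type} (A : Set S) (m : {x // x ∉ A} → ℕ) (k : A → ℕ) :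
    glue Aᶜ (fun x => k ⟨x, not_not.1 x.2⟩) m = glue A m k := by
  funext x
  by_cases hx : x ∈ A
  · rw [glue_of_mem A _ _ hx, glue_of_notMem Aᶜ _ _ (not_not.2 hx)]
  · rw [glue_of_notMem A _ _ hx, glue_of_mem Aᶜ _ _ hx]

variable {S : Type} [Fintype S] (A : Set S) [Fintype {x // x ∉ A}]
  {ρ : Fock S →L[ℂ] Fock S} {b : HilbertBasis (S → ℕ) ℂ (Fock S)} {r : (S → ℕ) → ℝ} {C : ℝ}

/-- The reduced density matrix of the complement, on the sites `{x // x ∉ A}`. -/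
def reducedCompl (ρ : Fock S →L[ℂ] Fock S) : Fock {x // x ∉ A} →L[ℂ] Fock {x // x ∉ A} :=
  reduced Aᶜ ρ

theorem IsDensity.isMarginals [Fintype A] (h : IsDensity ρ b r) (hC0 : 0 ≤ C)
    (hC : ∀ i, r i ≤ C * Real.exp (-(3 * deg i))) :
    IsMarginals ρ (reduced A ρ) (reducedCompl A ρ) := by
  classical
  refine ⟨h.hasSum_entry_reduced A hC0 hC, fun m n => ?_⟩
  have h1 := h.hasSum_entry_reduced Aᶜ hC0 hC m n
  -- The sites traced out for `Aᶜ` are those of `A` up to a double negation.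
  let e : (A → ℕ) ≃ ({x // x ∉ Aᶜ} → ℕ) :=
    { toFun := fun k x => k ⟨x, not_not.1 x.2⟩
      invFun := fun k x => k ⟨x, not_not.2 x.2⟩
      left_inv := fun _ => rfl
      right_inv := fun _ => rfl }
  have h2 := e.hasSum_iff.2 h1
  convert! h2 using 1
  funext k
  exact congrArg₂ (entry ρ) (glue_compl A m k).symm (glue_compl A n k).symm

theorem IsDensity.exists_isDensity_reducedCompl (h : IsDensity ρ b r) (hC0 : 0 ≤ C)
    (hC : ∀ i, r i ≤ C * Real.exp (-(3 * deg i))) :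
    ∃ v q, IsDensity (reducedCompl A ρ) v q := by
  classical
  let _ : Fintype (Aᶜ : Set S) := ‹Fintype {x // x ∉ A}›
  exact h.exists_isDensity_reduced Aᶜ hC0 hC

end Complement

/-! ### Density bound -/

section DensityBound

variable {S : Type} [Fintype S] [DecidableEq S] {G : SimpleGraph S} {J U μ β Z : ℝ}
  {b : HilbertBasis (S → ℕ) ℂ (Fock S)} {ε : (S → ℕ) → ℝ} {ρ : Fock S →L[ℂ] Fock S}

open scoped Classical in
-- Since ln Z ≥ 0, β tr(ρH) ≤ S(ρ). Insert the lower bound on the energy and the upper bound on the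
-- entropy, both proportional to the number of sites, and divide by that number.
theorem IsEigenbasis.density_ineq [Nonempty S] (hb : IsEigenbasis G J U μ b ε) (hU : 0 < U)
    (hβ : 0 < β) (hZ : 1 ≤ Z) (hρ : IsDensity ρ b fun i => Real.exp (-β * ε i) / Z) {Δ : ℝ}
    (hΔ : ∀ x, (∑ y, if G.Adj x y then (1 : ℝ) else 0) ≤ Δ) {n : ℝ}
    (hn : ∀ x, mean x (diag ρ) = n) :
    β * (U / 2 * (n ^ 2 - n) - (Δ * |J| + μ) * n) ≤ Real.log 2 * (n + 1) := by
  obtain ⟨h0, h1⟩ := hb.entropy_gibbs (by linarith) hρ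
  have h2 := hρ.entropy_le
  have h3 := le_totalEnergy G J U μ hΔ hρ.diag_nonneg hρ.hasSum_diag hρ.norm_entry_sq_le
    hρ.summable_sq hU.le
  simp only [hn, Finset.sum_const, nsmul_eq_mul] at h2 h3
  have hcard : (0 : ℝ) < (Finset.univ : Finset S).card := by
    exact_mod_cast Finset.card_pos.2 Finset.univ_nonempty
  have hn0 : 0 ≤ n := by
    obtain ⟨x⟩ := ‹Nonempty S›
    rw [← hn x]
    exact tsum_nonneg fun k => mul_nonneg (Nat.cast_nonneg _) (hρ.diag_nonneg k)
  have hlog2 : 0 ≤ Real.log 2 := Real.log_nonneg one_le_two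
  rw [h1, ENNReal.ofReal_le_ofReal_iff (by positivity)] at h2
  have h4 := Real.log_nonneg hZ
  have h5 := mul_le_mul_of_nonneg_left h3 hβ.le
  refine le_of_mul_le_mul_left ?_ hcard
  linarith

/-- The repulsion is quadratic in `n` and the entropy only linear, so βn is bounded. The term 4/U
survives as β → 0, which is why max(1, β) appears. -/
theorem mul_density_le {β U g n : ℝ} (hβ : 0 < β) (hU : 0 < U) (hg : 0 ≤ g)
    (h : β * (U / 2 * (n ^ 2 - n) - g * n) ≤ Real.log 2 * (n + 1)) :
    β * n ≤ 4 * (max 1 β * ((g + 1) / U + 1 / 2)) := by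
  have hM1 : 1 ≤ max 1 β := le_max_left _ _
  have hM2 : β ≤ max 1 β := le_max_right _ _
  set M := max 1 β
  have hlog : Real.log 2 ≤ 1 := by linarith [Real.log_two_lt_d9]
  have hpos : 0 ≤ M * ((g + 1) / U) := by positivity
  rcases le_or_gt n 1 with hn | hn
  · nlinarith
  -- For `n > 1`, ln 2 · (n + 1) ≤ 2n, so a factor `n` divides out.
  · have h1 : β * (U / 2 * (n - 1) - g) ≤ 2 := by
      have h2 : n * (β * (U / 2 * (n - 1) - g)) ≤ n * 2 := by
        calc n * (β * (U / 2 * (n - 1) - g)) = β * (U / 2 * (n ^ 2 - n) - g * n) := by ring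
          _ ≤ Real.log 2 * (n + 1) := h
          _ ≤ 1 * (n + 1) := by gcongr
          _ ≤ n * 2 := by linarith
      exact le_of_mul_le_mul_left h2 (by linarith)
    have h3 : β * n ≤ β + 2 * (β * g) / U + 4 / U := by
      have h4 : U * (β * n) ≤ U * (β + 2 * (β * g) / U + 4 / U) := by
        have : U * (β + 2 * (β * g) / U + 4 / U) = U * β + 2 * (β * g) + 4 := by
          field_simp
        rw [this]
        linarith
      exact le_of_mul_le_mul_left h4 hU
    have h5 : 2 * (β * g) / U ≤ 4 * (M * (g / U)) := by
      rw [mul_div_assoc, mul_div_assoc]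
      have : β * (g / U) ≤ M * (g / U) := by gcongr
      have h0 : 0 ≤ M * (g / U) := by positivity
      linarith
    have h6 : 4 / U ≤ 4 * (M * (1 / U)) := by
      have : 1 * (1 / U) ≤ M * (1 / U) := by gcongr
      calc 4 / U = 4 * (1 * (1 / U)) := by ring
        _ ≤ _ := by linarith
    rw [add_div]
    linarith

end DensityBound

/-! ### Geometry of the periodic box -/

section Box

variable {d L : ℕ}

theorem boxGraph_adj {x y : Box d L} : (boxGraph d L).Adj x y ↔
    x ≠ y ∧ ((∃ i, y = x + Pi.single i 1) ∨ ∃ i, x = y + Pi.single i 1) := Iff.rfl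

theorem boxGraph_adj_add (a x y : Box d L) :
    (boxGraph d L).Adj (x + a) (y + a) ↔ (boxGraph d L).Adj x y := by
  simp only [boxGraph_adj, ne_eq, add_left_inj, add_right_comm _ a]

variable [NeZero L]

open scoped Classical in
-- All neighbours are among `x ± e_i`. These may coincide with each other or with `x` for small `L`,
-- hence only an inequality.
theorem boxGraph_degree_le (x : Box d L) :
    (∑ y, if (boxGraph d L).Adj x y then (1 : ℝ) else 0) ≤ 2 * d := by
  have h : ∀ y, (if (boxGraph d L).Adj x y then (1 : ℝ) else 0) ≤
      ∑ i : Fin d, ((if y = x + Pi.single i 1 then 1 else 0) +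
        if y = x - Pi.single i 1 then 1 else 0) := by
    intro y
    have h0 : ∀ i : Fin d, (0 : ℝ) ≤ (if y = x + Pi.single i 1 then 1 else 0) +
        if y = x - Pi.single i 1 then 1 else 0 := fun i => by positivity
    by_cases hxy : (boxGraph d L).Adj x y
    · rw [if_pos hxy]
      obtain ⟨-, ⟨i, hi⟩ | ⟨i, hi⟩⟩ := boxGraph_adj.1 hxy
      · refine le_trans ?_ (Finset.single_le_sum (fun i _ => h0 i) (Finset.mem_univ i))
        rw [if_pos hi]
        simp only [le_add_iff_nonneg_right]
        positivity
      · refine le_trans ?_ (Finset.single_le_sum (fun i _ => h0 i) (Finset.mem_univ i))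
        rw [if_pos (eq_sub_of_add_eq hi.symm) (c := y = x - Pi.single i 1)]
        simp only [le_add_iff_nonneg_left]
        positivity
    · rw [if_neg hxy]
      exact Finset.sum_nonneg fun i _ => h0 i
  refine (Finset.sum_le_sum fun y _ => h y).trans (le_of_eq ?_)
  rw [Finset.sum_comm]
  simp only [Finset.sum_add_distrib, Finset.sum_ite_eq', Finset.mem_univ, if_true,
    Finset.sum_const, Finset.card_univ, Fintype.card_fin]
  simp
  ring

/-- A step up leaves the slab only from its last layer `w - 1`: below it, `z.val + 1 < w ≤ L` rules
out wrapping around. -/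
theorem eq_natCast_of_val_lt_of_le {z : ZMod L} {w : ℕ} (hw : w ≤ L) (h1 : z.val < w)
    (h2 : ¬(z + 1).val < w) : z = ((w - 1 : ℕ) : ZMod L) := by
  have h3 : z.val + 1 = w := by
    by_contra hne
    have hlt : z.val + 1 < w := by omega
    refine h2 ?_
    have : z + 1 = ((z.val + 1 : ℕ) : ZMod L) := by simp
    rw [this, ZMod.val_natCast_of_lt (by omega)]
    exact hlt
  rw [← h3, Nat.add_sub_cancel, ZMod.natCast_zmod_val]

theorem eq_zero_of_val_lt_of_le {z : ZMod L} {w : ℕ} (h1 : z.val < w) (h2 : ¬(z - 1).val < w) :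
    z = 0 := by
  by_contra hz
  have hpos : z.val ≠ 0 := fun h => hz ((ZMod.val_eq_zero z).1 h)
  refine h2 ?_
  have : z - 1 = ((z.val - 1 : ℕ) : ZMod L) := by
    rw [Nat.cast_sub (by omega)]
    simp
  have hL := ZMod.val_lt z
  rw [this, ZMod.val_natCast_of_lt (by omega)]
  omega

/-- Only steps in direction `j` change membership: up from the last layer or down from the first. -/
theorem slab_boundary {j : Fin d} {s : ZMod L} {w : ℕ} (hw : w ≤ L) {x y : Box d L}
    (hxy : (boxGraph d L).Adj x y) (hx : x ∈ slab j s w) (hy : y ∉ slab j s w) :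
    (x j = s + ((w - 1 : ℕ) : ZMod L) ∧ y = x + Pi.single j 1) ∨
      (x j = s ∧ y = x - Pi.single j 1) := by
  have hx' : (x j - s).val < w := hx
  have hy' : ¬(y j - s).val < w := hy
  obtain ⟨-, ⟨i, rfl⟩ | ⟨i, hi⟩⟩ := boxGraph_adj.1 hxy
  · by_cases hij : i = j
    · subst hij
      refine Or.inl ⟨?_, rfl⟩
      have h : (x + Pi.single i 1 : Box d L) i - s = (x i - s) + 1 := by
        simp
        ring
      rw [h] at hy'
      rw [← eq_natCast_of_val_lt_of_le hw hx' hy']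
      ring
    · refine absurd hx' ?_
      simpa [Ne.symm hij] using hy'
  · have hyx : y = x - Pi.single i 1 := eq_sub_of_add_eq hi.symm
    subst hyx
    by_cases hij : i = j
    · subst hij
      refine Or.inr ⟨?_, rfl⟩
      have h : (x - Pi.single i 1 : Box d L) i - s = (x i - s) - 1 := by
        simp
        ring
      rw [h] at hy'
      exact sub_eq_zero.1 (eq_zero_of_val_lt_of_le hx' hy')
    · refine absurd hx' ?_
      simpa [Ne.symm hij] using hy'

theorem card_layer (j : Fin d) (c : ZMod L) :
    (Finset.univ.filter fun x : Box d L => x j = c).card = L ^ (d - 1) := by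
  have h : (Finset.univ.filter fun x : Box d L => x j = c) =
      Fintype.piFinset fun i => if i = j then {c} else Finset.univ := by
    ext x
    simp only [Finset.mem_filter, Finset.mem_univ, true_and, Fintype.mem_piFinset]
    constructor
    · intro hx i
      split_ifs with hi
      · simp [hi, hx]
      · simp
    · intro hx
      simpa using hx j
  rw [h, Fintype.card_piFinset]
  have h2 : ∀ i : Fin d, (if i = j then ({c} : Finset (ZMod L)) else Finset.univ).card =
      if i = j then 1 else L := by
    intro i
    split_ifs
    · simp
    · simp [ZMod.card]
  simp only [h2]
  rw [Finset.prod_ite, Finset.prod_const_one, one_mul, Finset.prod_const, Finset.filter_ne',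
    Finset.card_erase_of_mem (Finset.mem_univ _), Finset.card_univ, Fintype.card_fin]

open scoped Classical in
-- The 4 is two faces of L^(d-1) sites times two orientations of each ordered pair.
theorem sum_boundary_le {j : Fin d} {s : ZMod L} {w : ℕ} (hw : w ≤ L) :
    (∑ x : Box d L, ∑ y, if (boxGraph d L).Adj x y ∧ ¬(x ∈ slab j s w ↔ y ∈ slab j s w) then
      (1 : ℝ) else 0) ≤ 4 * (L : ℝ) ^ (d - 1) := by
  set A := slab j s w
  let F : Box d L → Box d L → ℝ := fun x y =>
    if (boxGraph d L).Adj x y ∧ x ∈ A ∧ y ∉ A then 1 else 0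
  have hsplit : ∀ x y, (if (boxGraph d L).Adj x y ∧ ¬(x ∈ A ↔ y ∈ A) then (1 : ℝ) else 0) =
      F x y + F y x := by
    intro x y
    have hsymm := (boxGraph d L).adj_comm x y
    simp only [F, ← hsymm]
    by_cases hxy : (boxGraph d L).Adj x y <;> by_cases hx : x ∈ A <;> by_cases hy : y ∈ A <;>
      simp [hxy, hx, hy]
  have hF : ∑ x, ∑ y, F x y ≤ 2 * (L : ℝ) ^ (d - 1) := by
    have hle : ∀ x y, F x y ≤
        (if x j = s + ((w - 1 : ℕ) : ZMod L) then if y = x + Pi.single j 1 then 1 else 0 else 0) +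
          if x j = s then if y = x - Pi.single j 1 then 1 else 0 else 0 := by
      intro x y
      by_cases h : (boxGraph d L).Adj x y ∧ x ∈ A ∧ y ∉ A
      · simp only [F, if_pos h]
        obtain ⟨h1, h2⟩ | ⟨h1, h2⟩ := slab_boundary hw h.1 h.2.1 h.2.2
        · rw [if_pos h1, if_pos h2]
          simp only [le_add_iff_nonneg_right]
          positivity
        · rw [if_pos h1, if_pos h2]
          simp only [le_add_iff_nonneg_left]
          positivity
      · simp only [F, if_neg h]
        positivity
    refine (Finset.sum_le_sum fun x _ => Finset.sum_le_sum fun y _ => hle x y).trans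
      (le_of_eq ?_)
    have hinner : ∀ (P : Prop) [Decidable P] (z : Box d L),
        (∑ y : Box d L, if P then if y = z then (1 : ℝ) else 0 else 0) = if P then 1 else 0 := by
      intro P _ z
      split_ifs <;> simp
    simp only [Finset.sum_add_distrib, hinner]
    rw [Finset.sum_boole, Finset.sum_boole, card_layer, card_layer]
    push_cast
    ring
  simp only [hsplit, Finset.sum_add_distrib]
  rw [Finset.sum_comm (f := fun x y => F y x)]
  linarith

end Box

end BoseHubbard

end

/-! ### The area law -/

open BoseHubbard in
theorem theorem1 (d L : ℕ) [NeZero L] (J U μ β : ℝ) (hU : 0 < U) (hμ : 0 < μ) (hβ : 0 < β)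
    (j : Fin d) (s : ZMod L) (LA : ℕ) (hLA : 1 ≤ LA) (hLAL : LA ≤ L) :
    (∃ ρ : Fock (Box d L) →L[ℂ] Fock (Box d L),
      IsGibbsState (hamiltonian (boxGraph d L) J U μ) β ρ) ∧
    ∀ ρ : Fock (Box d L) →L[ℂ] Fock (Box d L),
      IsGibbsState (hamiltonian (boxGraph d L) J U μ) β ρ →
        entropy ρ ≠ ⊤ ∧
        entropy (reduced (slab j s LA) ρ) ≠ ⊤ ∧
        entropy (reduced (slab j s LA)ᶜ ρ) ≠ ⊤ ∧
        mutualInformation (slab j s LA) ρ ≤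
          areaConst d J U μ * max 1 β * (L : ℝ) ^ (d - 1) := by
  classical
  refine ⟨exists_isGibbsState _ J U μ hU hβ, fun ρ hGibbs => ?_⟩
  obtain ⟨b, ε, hb⟩ := exists_isEigenbasis (boxGraph d L) J U μ
  obtain ⟨Z, hZ, hsum, happly⟩ := hb.gibbs hU hβ hGibbs
  have hZ0 : 0 < Z := by linarith
  obtain ⟨⟨C, hC0, hC⟩, hρ⟩ := hb.isDensity hU hβ hZ hsum happly
  set A := slab j s LA
  obtain ⟨u, p, hA⟩ := hρ.exists_isDensity_reduced A hC0 hC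
  obtain ⟨v, q, hB⟩ := hρ.exists_isDensity_reducedCompl A hC0 hC
  have hM := hρ.isMarginals A hC0 hC
  refine ⟨ne_top_of_le_ne_top ENNReal.ofReal_ne_top hρ.entropy_le,
    ne_top_of_le_ne_top ENNReal.ofReal_ne_top hA.entropy_le,
    ne_top_of_le_ne_top (b := entropy (reducedCompl A ρ))
      (ne_top_of_le_ne_top ENNReal.ofReal_ne_top hB.entropy_le) le_rfl, ?_⟩
  have hI : mutualInformation A ρ ≤ β * (|J| * ∑ x, ∑ y,
      if (boxGraph d L).Adj x y ∧ ¬(x ∈ A ↔ y ∈ A) then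
        (mean x (diag ρ) + mean y (diag ρ)) / 2 else 0) :=
    hb.mutual_le hβ hZ0 hρ hA hB hM
  set n := mean 0 (diag ρ) with hn_def
  -- Translations are automorphisms of the periodic box, so every site has the mean occupation of
  -- the origin.
  have hn : ∀ x, mean x (diag ρ) = n := by
    intro x
    have h := mean_perm (p := diag ρ) (Equiv.addRight x) (fun k =>
      hb.diag_comp_perm (g := fun e => ((Real.exp (-β * e) / Z : ℝ) : ℂ)) happly _
        (fun y z => boxGraph_adj_add x y z) k) 0
    simpa using h
  have hn0 : 0 ≤ n := tsum_nonneg fun k => mul_nonneg (Nat.cast_nonneg _) (hρ.diag_nonneg k)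
  have hbound := mul_density_le hβ hU (by positivity : 0 ≤ 2 * (d : ℝ) * |J| + μ)
    (hb.density_ineq hU hβ hZ hρ (fun x => boxGraph_degree_le x) hn)
  have hcount : (∑ x : Box d L, ∑ y, if (boxGraph d L).Adj x y ∧ ¬(x ∈ A ↔ y ∈ A) then
        (mean x (diag ρ) + mean y (diag ρ)) / 2 else 0) ≤ n * (4 * (L : ℝ) ^ (d - 1)) := by
    refine le_trans (le_of_eq ?_) (mul_le_mul_of_nonneg_left
      (sum_boundary_le (j := j) (s := s) hLAL) hn0)
    rw [Finset.mul_sum]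
    refine Finset.sum_congr rfl fun x _ => ?_
    rw [Finset.mul_sum]
    refine Finset.sum_congr rfl fun y _ => ?_
    rw [hn, hn, add_self_div_two, mul_ite, mul_one, mul_zero]
  set g := 2 * (d : ℝ) * |J| + μ with hg
  have hg0 : 0 ≤ g := by positivity
  -- Here `g + 1` is the G of the statement; the first two summands of the constant are nonnegative
  -- and are discarded.
  have hconst : 16 * |J| * ((g + 1) / U + 1 / 2) ≤ areaConst d J U μ := by
    have hG : 2 * (d : ℝ) * |J| + 1 + μ = g + 1 := by rw [hg]; ring
    rw [areaConst, hG]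
    refine mul_le_mul_of_nonneg_left ?_ (by positivity)
    have h1 : 0 ≤ (16 + 4 * 6 ^ (2 * (d - 1)) * ((Real.exp 1 - 1) ^ 2)⁻¹) / (2 * (g + 1)) := by
      positivity
    have h2 : 0 ≤ 1 / 16 * (U / (g + 1)) := by positivity
    linarith
  -- The factor 16 is 4 from counting boundary pairs times 4 from the bound on βn.
  calc mutualInformation A ρ
      ≤ β * (|J| * (n * (4 * (L : ℝ) ^ (d - 1)))) := hI.trans (by gcongr)
    _ = 4 * |J| * (β * n) * (L : ℝ) ^ (d - 1) := by ring
    _ ≤ 4 * |J| * (4 * (max 1 β * ((g + 1) / U + 1 / 2))) * (L : ℝ) ^ (d - 1) := by gcongr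
    _ = 16 * |J| * ((g + 1) / U + 1 / 2) * max 1 β * (L : ℝ) ^ (d - 1) := by ring
    _ ≤ areaConst d J U μ * max 1 β * (L : ℝ) ^ (d - 1) := by gcongr
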